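/- Let $\sigma>0$, weights $\alpha_1,\dots,\alpha_K>0$, channels $h_1,\dots,h_K\in\mathbb C^N$, $P_A\ge 0$, and let $A\in\mathbb C^{N\times N}$ be positive semidefinite of rank $m\le N$ with $\mathrm{Null}(A)\subseteq \mathrm{Null}\big(\sum_i h_ih_i^H\big)$. Let $A=[U_1,U_2]\Lambda[U_1,U_2]^H$ be a singular value decomposition, $[U_1,U_2]$ unitary, where $U_1\in\mathbb C^{N\times m}$ and $U_2\in\mathbb C^{N\times(N-m)}$ belong to the non-zero and to the zero singular values. For a permutation $\pi$ of $\{1,\dots,K\}$ (an encoding order) let $\mathcal C_\pi(\{S_i\},\{h_i\})$ be the set of $r\in\mathbb R_{\ge0}^K$ with $$r_{\pi(i)}\le\log_2\frac{\sigma^2+h_{\pi(i)}^H\big(\sum_{k\ge i}S_{\pi(k)}\big)h_{\pi(i)}}{\sigma^2+h_{\pi(i)}^H\big(\sum_{k> i}S_{\pi(k)}\big)h_{\pi(i)}}\quad\text{for all } i,$$ and let $\mathcal C_{\rm BC}=\bigcup_\pi\mathcal C_\pi$. Consider the problem $$\text{(I)}\quad \max_{\{S_i\},r}\ \sum_i\alpha_ir_i\quad\text{s.t.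 } r\in\mathcal C_{\rm BC}(\{S_i\},\{h_i\}),\ \ \sum_i\mathrm{Tr}(AS_i)\le P_A,\ \ S_i\succeq0,$$ and the reduced problem (II): the same problem for matrices $B_i\in\mathbb C^{m\times m}$, with $h_i$, $A$ replaced by $\hat h_i=U_1^Hh_i$, $\hat A=U_1^HAU_1$. Then: 1. $\hat A$ is positive definite and (II) has an optimal solution. 2. $(\{\bar S_i\},r)$ is optimal for (I) if and only if there are an optimal solution $(\{\bar B_i\},r)$ of (II) and matrices $\bar C_i\in\mathbb C^{m\times(N-m)}$, $\bar D_i\in\mathbb C^{(N-m)\times(N-m)}$ such that for all $i$ $$\bar S_i=U_1\bar B_iU_1^H+U_1\bar C_iU_2^H+U_2\bar C_i^HU_1^H+U_2\bar D_iU_2^H\quad\text{and}\quad \bar S_i\succeq0 .$$ (So $\bar C_i,\bar D_i$ are arbitrary subject to $\bar S_i\succeq 0$.) 3. If not all $h_i$ vanish and the weights $\alpha_i$ are pairwise distinct, then the optimal solution $(\{\bar B_i\},r)$ of (II) is unique. If weights may coincide, but for every value $c$ the matrices $\hat h_i\hat h_i^H$ with $\alpha_i=c$ are linearly independent over $\mathbb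 R$, then for every encoding order $\pi$ with $\alpha_{\pi(1)}\ge\dots\ge\alpha_{\pi(K)}$ the problem (II) with $\mathcal C_\pi$ in place of $\mathcal C_{\rm BC}$ has a unique optimal solution. 4. If not all $h_i$ vanish, then $\mathrm{rank}(\bar B_i)\le1$ for all $i$ in every optimal solution of (II). 5. (BC–MAC duality.) Let $\pi$ satisfy $\alpha_{\pi(1)}\ge\dots\ge\alpha_{\pi(K)}$. For $p\in\mathbb R_{\ge0}^K$ put $M_i(p)=\hat A+\sum_{k\le i}p_{\pi(k)}\hat h_{\pi(k)}\hat h_{\pi(k)}^H$ for $0\le i\le K$, and $r^{(m)}_{\pi(i)}(p)=\log_2\frac{\det M_i(p)}{\det M_{i-1}(p)}$. The problem of maximizing $\sum_i\alpha_ir_i^{(m)}(p)$ subject to $p\ge0$, $\sigma^2\sum_ip_i\le P_A$ has an optimal solution. For each of its optimal solutions $p$, let $v_{\pi(i)}$ be the vector $M_{i-1}(p)^{-1}\hat h_{\pi(i)}$ divided by its Euclidean norm; then there is $q\in\mathbb R_{\ge0}^K$ with $$q_{\pi(i)}=\frac{2^{r^{(m)}_{\pi(i)}(p)}-1}{|\hat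 h_{\pi(i)}^Hv_{\pi(i)}|^2}\Big(\sum_{k>i}q_{\pi(k)}|\hat h_{\pi(i)}^Hv_{\pi(k)}|^2+\sigma^2\Big)\quad\text{for all } i$$ (with $v_j=0$, $q_j=0$ if $\hat h_j=0$), the rates $r^{(m)}(p)$ lie in $\mathcal C_\pi(\{\bar B_i\},\{\hat h_i\})$ for $\bar B_i=w_iw_i^H$, $w_i=\sqrt{q_i}\,v_i$, and $(\{\bar B_i\},r^{(m)}(p))$ is an optimal solution of (II). -/

import Mathlib

open scoped ComplexOrder

noncomputable section

namespace MISOBC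

open Matrix

variable {ι : Type*} [Fintype ι] {K : ℕ}

/-- The received power `hᴴ S h` of a signal with covariance `S` over the channel `h`
(a real number for Hermitian `S`). -/
def rxPower (h : ι → ℂ) (S : Matrix ι ι ℂ) : ℝ :=
  (star h ⬝ᵥ (S *ᵥ h)).re

/-- The dirty-paper-coding rate (in bps/Hz) of the `i`-th encoded user, that is of user `π i`,
for the encoding order `π` and noise power `nv`: only the users encoded later interfere. -/
def dpcRate (nv : ℝ) (h : Fin K → ι → ℂ) (S : Fin K → Matrix ι ι ℂ)
    (π : Equiv.Perm (Fin K)) (i : Fin K) : ℝ :=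
  Real.logb 2
    ((nv + rxPower (h (π i)) (∑ k ∈ Finset.Ici i, S (π k))) /
      (nv + rxPower (h (π i)) (∑ k ∈ Finset.Ioi i, S (π k))))

/-- The rate tuples achievable with the fixed encoding order `π`. -/
def orderRegion (nv : ℝ) (h : Fin K → ι → ℂ) (π : Equiv.Perm (Fin K))
    (S : Fin K → Matrix ι ι ℂ) : Set (Fin K → ℝ) :=
  {r | (∀ i, 0 ≤ r i) ∧ ∀ i, r (π i) ≤ dpcRate nv h S π i}

/-- The achievable rate region `C_BC({S_i}, {h_i})`: the union over all encoding orders. -/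
def bcRegion (nv : ℝ) (h : Fin K → ι → ℂ) (S : Fin K → Matrix ι ι ℂ) : Set (Fin K → ℝ) :=
  ⋃ π : Equiv.Perm (Fin K), orderRegion nv h π S

/-- The feasible points `({S_i}, r)` of the weighted sum-rate problem with the rate region `C`
and the single constraint `∑ i, Tr (A S_i) ≤ P`. -/
def wsrFeasible (C : (Fin K → Matrix ι ι ℂ) → Set (Fin K → ℝ)) (A : Matrix ι ι ℂ) (P : ℝ) :
    Set ((Fin K → Matrix ι ι ℂ) × (Fin K → ℝ)) :=
  {x | x.2 ∈ C x.1 ∧ (∑ i, (A * x.1 i).trace).re ≤ P ∧ ∀ i, (x.1 i).PosSemidef}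

/-- `({S_i}, r)` maximizes `∑ i, α_i r_i` over the feasible points. -/
def IsWsrOptimal (α : Fin K → ℝ) (C : (Fin K → Matrix ι ι ℂ) → Set (Fin K → ℝ))
    (A : Matrix ι ι ℂ) (P : ℝ) (x : (Fin K → Matrix ι ι ℂ) × (Fin K → ℝ)) : Prop :=
  x ∈ wsrFeasible C A P ∧ IsMaxOn (fun y => ∑ i, α i * y.2 i) (wsrFeasible C A P) x

/-- `A = [U₁, U₂] Λ [U₁, U₂]ᴴ` with `[U₁, U₂]` unitary and `Λ` diagonal, where the diagonal
entries that belong to `U₁` are positive and those that belong to `U₂` vanish. -/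
def IsSplitSVD {μ ν : Type*} [Fintype μ] [Fintype ν] [DecidableEq ι] [DecidableEq μ]
    [DecidableEq ν] (A : Matrix ι ι ℂ) (U₁ : Matrix ι μ ℂ) (U₂ : Matrix ι ν ℂ) : Prop :=
  fromCols U₁ U₂ * (fromCols U₁ U₂).conjTranspose = 1 ∧
  (fromCols U₁ U₂).conjTranspose * fromCols U₁ U₂ = 1 ∧
  ∃ d : μ → ℝ, (∀ i, 0 < d i) ∧
    A = fromCols U₁ U₂ *
      (diagonal (Sum.elim (fun i => (d i : ℂ)) (fun _ => 0)) : Matrix (μ ⊕ ν) (μ ⊕ ν) ℂ) *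
      (fromCols U₁ U₂).conjTranspose

/-! ### The dual multiple access channel -/

/-- The matrix `A + ∑ k ∈ s, p_{π k} h_{π k} h_{π k}ᴴ`: noise plus the signals of the users
at the positions in `s`. -/
def macCov (A : Matrix ι ι ℂ) (h : Fin K → ι → ℂ) (π : Equiv.Perm (Fin K)) (p : Fin K → ℝ)
    (s : Finset (Fin K)) : Matrix ι ι ℂ :=
  A + ∑ k ∈ s, (p (π k) : ℂ) • vecMulVec (h (π k)) (star (h (π k)))

/-- The dual MAC rate of user `π i`, who is decoded in the presence of the users at the earlier
positions. -/
def macRateAt [DecidableEq ι] (A : Matrix ι ι ℂ) (h : Fin K → ι → ℂ) (π : Equiv.Perm (Fin K))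
    (p : Fin K → ℝ) (i : Fin K) : ℝ :=
  Real.logb 2
    ((macCov A h π p (Finset.Iic i)).det.re / (macCov A h π p (Finset.Iio i)).det.re)

/-- The tuple of dual MAC rates, indexed by the users. -/
def macRate [DecidableEq ι] (A : Matrix ι ι ℂ) (h : Fin K → ι → ℂ) (π : Equiv.Perm (Fin K))
    (p : Fin K → ℝ) (j : Fin K) : ℝ :=
  macRateAt A h π p (π.symm j)

/-- The feasible powers of the dual MAC: `p_i ≥ 0` and `nv * ∑ i, p_i ≤ P`. -/
def macFeasible (K : ℕ) (nv P : ℝ) : Set (Fin K → ℝ) :=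
  {p | (∀ i, 0 ≤ p i) ∧ nv * ∑ i, p i ≤ P}

/-- `p` maximizes the weighted sum rate of the dual MAC. -/
def IsMacOptimal [DecidableEq ι] (α : Fin K → ℝ) (nv : ℝ) (A : Matrix ι ι ℂ)
    (h : Fin K → ι → ℂ) (P : ℝ) (π : Equiv.Perm (Fin K)) (p : Fin K → ℝ) : Prop :=
  p ∈ macFeasible K nv P ∧
    IsMaxOn (fun p' => ∑ j, α j * macRate A h π p' j) (macFeasible K nv P) p

/-- The normalized MMSE receive beamformer of user `j` in the dual MAC
(zero if the channel of `j` is zero). -/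
def mmseBeam [DecidableEq ι] (A : Matrix ι ι ℂ) (h : Fin K → ι → ℂ) (π : Equiv.Perm (Fin K))
    (p : Fin K → ℝ) (j : Fin K) : ι → ℂ :=
  let u : ι → ℂ := (macCov A h π p (Finset.Iio (π.symm j)))⁻¹ *ᵥ h j
  ((‖WithLp.toLp 2 u‖⁻¹ : ℝ) : ℂ) • u

/-- `q` solves the triangular system of downlink powers: with the beamformers of the dual MAC,
every user obtains in the broadcast channel its dual MAC rate. -/
def IsDownlinkPower [DecidableEq ι] (nv : ℝ) (A : Matrix ι ι ℂ) (h : Fin K → ι → ℂ)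
    (π : Equiv.Perm (Fin K)) (p q : Fin K → ℝ) : Prop :=
  ∀ i, q (π i) =
    ((2 : ℝ) ^ macRateAt A h π p i - 1) / ‖star (h (π i)) ⬝ᵥ mmseBeam A h π p (π i)‖ ^ 2 *
      (∑ k ∈ Finset.Ioi i, q (π k) * ‖star (h (π i)) ⬝ᵥ mmseBeam A h π p (π k)‖ ^ 2 + nv)

/-- The covariance `w_j w_jᴴ` with `w_j = √q_j v_j`, where `v_j` is the MMSE beamformer. -/
def beamCov [DecidableEq ι] (A : Matrix ι ι ℂ) (h : Fin K → ι → ℂ) (π : Equiv.Perm (Fin K))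
    (p q : Fin K → ℝ) (j : Fin K) : Matrix ι ι ℂ :=
  let w : ι → ℂ := ((Real.sqrt (q j) : ℝ) : ℂ) • mmseBeam A h π p j
  vecMulVec w (star w)

end MISOBC

end

open scoped ComplexOrder

namespace MISOBC

open Matrix
open scoped MatrixOrder

/-! ### Quadratic forms, Cauchy–Schwarz with its equality case, and rank-one updates. -/

section QuadraticForm

variable {ι : Type*} [Fintype ι]

/-! The reduced problem is solved through a dual multiple access channel (MAC), in which the matrix
`A` plays the role of the noise covariance.

Fix an order and covariances `S`. Let `s_i` be the received signal power of the `i`-th encoded user,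
`c_i` its noise plus interference, and `κ_i = hᴴ M_{i-1}⁻¹ h` its dual gain. The recursively defined
powers `p_i = s_i / (c_i κ_i)` give equal rates, since `p_i κ_i = s_i / c_i`. Cauchy–Schwarz gives
`p_i c_i = s_i / κ_i ≤ tr (M_{i-1} S_i)`. After summation the interference terms cancel
(`sum_trace_sub_sum_noise`), so the dual powers cost no more than `S`. If they cost the same, each
`S_i` is a multiple of the beam along `M_{i-1}⁻¹ h` (`exists_mac_of_bc`). Conversely, such beams
realise any dual rates within the same budget (`exists_isDownlinkPower`).

In the dual channel, exchanging two neighbours in the decoding order changes the weighted sum by a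
product whose sign is that of the weight difference, so sorted orders are best. For a sorted order,
summation by parts writes the objective as a combination of `log det M_i` with nonnegative
coefficients, up to a constant. Hence a maximizer exists by compactness, it uses the whole budget
when some channel is non-zero, and strict concavity of `log det` fixes `M_i` wherever the weight
drops (`IsMacOptimal.unique`).

An optimal broadcast point, in whatever order, thus yields an optimal `p` with full power, so its
covariances are beams determined by `p` and the order. This gives rank at most one, and uniqueness
for a sorted order. For distinct weights an optimal point of an unsorted order also lies in the
sorted region: each exchange towards sorting gains nothing, which happens only when one of the two
users is silent or the new interference vanishes.

Problem (I) reduces to (II) because `A = U₁ A' U₁ᴴ` and `h_i = U₁ h'_i`, so constraint and rates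
depend on `S` only through `U₁ᴴ S U₁`. -/

lemma rxPower_add (h : ι → ℂ) (S T : Matrix ι ι ℂ) :
    rxPower h (S + T) = rxPower h S + rxPower h T := by
  simp [rxPower, add_mulVec, dotProduct_add]

@[simp] lemma rxPower_zero (h : ι → ℂ) : rxPower h 0 = 0 := by
  simp [rxPower]

@[simp] lemma rxPower_zero_left (S : Matrix ι ι ℂ) : rxPower 0 S = 0 := by
  simp [rxPower]

lemma rxPower_sum {κ : Type*} (h : ι → ℂ) (s : Finset κ) (S : κ → Matrix ι ι ℂ) :
    rxPower h (∑ k ∈ s, S k) = ∑ k ∈ s, rxPower h (S k) := by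
  classical
  induction s using Finset.induction_on with
  | empty => simp
  | insert a s ha ih => rw [Finset.sum_insert ha, Finset.sum_insert ha, rxPower_add, ih]

lemma rxPower_smul (h : ι → ℂ) (c : ℝ) (S : Matrix ι ι ℂ) :
    rxPower h ((c : ℂ) • S) = c * rxPower h S := by
  simp [rxPower, smul_mulVec, dotProduct_smul]

lemma rxPower_nonneg (h : ι → ℂ) {S : Matrix ι ι ℂ} (hS : S.PosSemidef) : 0 ≤ rxPower h S :=
  (Complex.le_def.1 (hS.dotProduct_mulVec_nonneg h)).1

lemma coe_rxPower (h : ι → ℂ) {S : Matrix ι ι ℂ} (hS : S.PosSemidef) :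
    (rxPower h S : ℂ) = star h ⬝ᵥ (S *ᵥ h) := by
  have := (Complex.le_def.1 (hS.dotProduct_mulVec_nonneg h)).2
  apply Complex.ext
  · rfl
  · simpa using this

lemma rxPower_pos {h : ι → ℂ} (hh : h ≠ 0) {S : Matrix ι ι ℂ} (hS : S.PosDef) :
    0 < rxPower h S :=
  (Complex.lt_def.1 (hS.dotProduct_mulVec_pos hh)).1

lemma star_dotProduct_mulVec {S : Matrix ι ι ℂ} (hS : S.IsHermitian) (a b : ι → ℂ) :
    star (star a ⬝ᵥ (S *ᵥ b)) = star b ⬝ᵥ (S *ᵥ a) := by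
  rw [star_dotProduct, star_star, star_mulVec, hS.eq, ← dotProduct_mulVec, dotProduct_comm,
    dotProduct_comm]

lemma rxPower_vecMulVec (h w : ι → ℂ) :
    rxPower h (vecMulVec w (star w)) = ‖star h ⬝ᵥ w‖ ^ 2 := by
  have h2 : star w ⬝ᵥ h = star (star h ⬝ᵥ w) := by
    rw [star_dotProduct]
  rw [rxPower, vecMulVec_mulVec, h2]
  simp only [dotProduct_smul, MulOpposite.smul_eq_mul_unop, MulOpposite.unop_op]
  rw [← Complex.normSq_eq_norm_sq, ← Complex.ofReal_re (Complex.normSq _),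
    Complex.normSq_eq_conj_mul_self, mul_comm]
  rfl

lemma trace_vecMulVec_mul (h : ι → ℂ) (B : Matrix ι ι ℂ) :
    (vecMulVec h (star h) * B).trace = star h ⬝ᵥ (B *ᵥ h) := by
  rw [vecMulVec_mul, trace_vecMulVec, dotProduct_comm, dotProduct_mulVec]

lemma posSemidef_smul_vecMulVec {c : ℝ} (hc : 0 ≤ c) (h : ι → ℂ) :
    ((c : ℂ) • vecMulVec h (star h)).PosSemidef :=
  (posSemidef_vecMulVec_self_star h).smul (by exact_mod_cast hc)

lemma rxPower_eq_zero_of_eq_zero {h : ι → ℂ} {S : Matrix ι ι ℂ} (hS : S.PosDef)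
    (h0 : rxPower h S = 0) : h = 0 := by
  by_contra hh
  exact (rxPower_pos hh hS).ne' h0

/-! ### Traces of products of positive semidefinite matrices -/

lemma exists_conjTranspose_mul_self {S : Matrix ι ι ℂ} (hS : S.PosSemidef) :
    ∃ C : Matrix ι ι ℂ, S = Cᴴ * C := by
  classical
  obtain ⟨C, hC⟩ := CStarAlgebra.nonneg_iff_eq_star_mul_self.mp (nonneg_iff_posSemidef.2 hS)
  exact ⟨C, hC⟩

lemma trace_mul_nonneg {Q B : Matrix ι ι ℂ} (hQ : Q.PosSemidef) (hB : B.PosSemidef) :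
    0 ≤ (Q * B).trace := by
  obtain ⟨C, rfl⟩ := exists_conjTranspose_mul_self hB
  rw [← Matrix.mul_assoc, trace_mul_comm, ← Matrix.mul_assoc]
  exact (hQ.mul_mul_conjTranspose_same C).trace_nonneg

/-- With `Q = Dᴴ D` and `B = Cᴴ C` the trace is the squared Frobenius norm of `D Cᴴ`. -/
lemma mul_eq_zero_of_trace_eq_zero {Q B : Matrix ι ι ℂ} (hQ : Q.PosSemidef)
    (hB : B.PosSemidef) (h0 : (Q * B).trace = 0) : Q * B = 0 := by
  obtain ⟨C, rfl⟩ := exists_conjTranspose_mul_self hB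
  obtain ⟨D, rfl⟩ := exists_conjTranspose_mul_self hQ
  have h1 : ((D * Cᴴ)ᴴ * (D * Cᴴ)).trace = 0 := by
    rw [conjTranspose_mul, conjTranspose_conjTranspose, ← h0, ← Matrix.mul_assoc _ Cᴴ,
      trace_mul_comm _ C]
    simp only [Matrix.mul_assoc]
  rw [trace_conjTranspose_mul_self_eq_zero_iff] at h1
  rw [Matrix.mul_assoc, ← Matrix.mul_assoc D, h1]
  simp

lemma re_trace_sub_vecMulVec_mul (M B : Matrix ι ι ℂ) (c : ℝ) (h : ι → ℂ) :
    ((M - (c : ℂ) • vecMulVec h (star h)) * B).trace.re = (M * B).trace.re - c * rxPower h B := by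
  rw [Matrix.sub_mul, trace_sub, Matrix.smul_mul, trace_smul, trace_vecMulVec_mul]
  simp [rxPower]

lemma re_trace_mul_vecMulVec {M : Matrix ι ι ℂ} (w : ι → ℂ) :
    (M * vecMulVec w (star w)).trace.re = rxPower w M := by
  rw [trace_mul_comm, trace_vecMulVec_mul, rxPower]

lemma posDef_add_vecMulVec {M : Matrix ι ι ℂ} (hM : M.PosDef) {p : ℝ} (hp : 0 ≤ p)
    (h : ι → ℂ) : (M + (p : ℂ) • vecMulVec h (star h)).PosDef :=
  hM.add_posSemidef (posSemidef_smul_vecMulVec hp h)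

variable [DecidableEq ι]

lemma mul_inv_mulVec {M : Matrix ι ι ℂ} (hM : M.PosDef) (h : ι → ℂ) :
    M *ᵥ (M⁻¹ *ᵥ h) = h := by
  have : Invertible M := hM.isUnit.invertible
  rw [mulVec_mulVec, Matrix.mul_inv_of_invertible, one_mulVec]

/-- This is Cauchy–Schwarz in the inner product of `M`, as a matrix inequality: removing the
component along `M⁻¹ h` leaves a positive semidefinite form. -/
lemma posSemidef_sub_vecMulVec {M : Matrix ι ι ℂ} (hM : M.PosDef) {h : ι → ℂ} (hh : h ≠ 0) :
    (M - (((rxPower h M⁻¹)⁻¹ : ℝ) : ℂ) • vecMulVec h (star h)).PosSemidef := by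
  set κ : ℝ := rxPower h M⁻¹ with hκ
  have hκ0 : κ ≠ 0 := (rxPower_pos hh hM.inv).ne'
  have hκc : (κ : ℂ) = star h ⬝ᵥ (M⁻¹ *ᵥ h) := coe_rxPower h hM.inv.posSemidef
  set u := M⁻¹ *ᵥ h with hu
  have hMu : M *ᵥ u = h := mul_inv_mulVec hM h
  have huM : star u ᵥ* M = star h := by
    conv_rhs => rw [← hMu, star_mulVec, hM.1.eq]
  set c : ℂ := ((κ⁻¹ : ℝ) : ℂ) with hc
  have hcs : star c = c := Complex.conj_ofReal _
  have hcκ : c * κ = 1 := by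
    rw [hc, ← Complex.ofReal_mul, inv_mul_cancel₀ hκ0]; simp
  -- The factor `1 - κ⁻¹ u hᴴ` is the projection that kills `u = M⁻¹ h`; congruence of `M` by it is
  -- exactly the claimed difference.
  have key := hM.posSemidef.conjTranspose_mul_mul_same (1 - c • vecMulVec u (star h))
  convert key using 1
  have h1 : M * vecMulVec u (star h) = vecMulVec h (star h) := by
    rw [mul_vecMulVec, hMu]
  have h2 : vecMulVec h (star u) * M = vecMulVec h (star h) := by
    rw [vecMulVec_mul, huM]
  have h3 : vecMulVec h (star h) * vecMulVec u (star h) = (κ : ℂ) • vecMulVec h (star h) := by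
    rw [vecMulVec_mul_vecMulVec, ← hκc, vecMulVec_smul]
  have h4 : (1 - c • vecMulVec u (star h))ᴴ = 1 - c • vecMulVec h (star u) := by
    rw [conjTranspose_sub, conjTranspose_one, conjTranspose_smul, conjTranspose_vecMulVec,
      star_star, hcs]
  rw [h4]
  simp only [Matrix.sub_mul, Matrix.mul_sub, Matrix.one_mul, Matrix.mul_one, Matrix.smul_mul,
    Matrix.mul_smul, h1, h2, h3, smul_smul]
  rw [hcκ, one_smul, sub_self, smul_zero, sub_zero]

/-- Cauchy-Schwarz: the received power is at most the power spent times the channel gain. -/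
lemma rxPower_div_le_trace {M B : Matrix ι ι ℂ} (hM : M.PosDef) (hB : B.PosSemidef)
    (h : ι → ℂ) : rxPower h B / rxPower h M⁻¹ ≤ (M * B).trace.re := by
  by_cases hh : h = 0
  · subst hh
    simpa using (Complex.le_def.1 (trace_mul_nonneg hM.posSemidef hB)).1
  have h1 := (Complex.le_def.1 (trace_mul_nonneg (posSemidef_sub_vecMulVec hM hh) hB)).1
  rw [re_trace_sub_vecMulVec_mul] at h1
  rw [div_eq_inv_mul]
  simpa using h1

/-- Equality means that the positive semidefinite difference matrix multiplied by `B` has trace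
zero, hence vanishes. This expresses `B` through `u = M⁻¹ h` and `B h`, and Hermitian symmetry makes
`B h` parallel to `u`. -/
lemma eq_vecMulVec_of_rxPower_div_eq_trace {M B : Matrix ι ι ℂ} (hM : M.PosDef)
    (hB : B.PosSemidef) (h : ι → ℂ) (heq : rxPower h B / rxPower h M⁻¹ = (M * B).trace.re) :
    B = ((rxPower h B / rxPower h M⁻¹ / rxPower h M⁻¹ : ℝ) : ℂ) •
      vecMulVec (M⁻¹ *ᵥ h) (star (M⁻¹ *ᵥ h)) := by
  have : Invertible M := hM.isUnit.invertible
  have cancel : ∀ X Y : Matrix ι ι ℂ, M * X = Y → X = M⁻¹ * Y := by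
    rintro X _ rfl
    rw [← Matrix.mul_assoc, Matrix.inv_mul_of_invertible, Matrix.one_mul]
  by_cases hh : h = 0
  · subst hh
    have h0 : (M * B).trace = 0 := by
      have h1 := Complex.le_def.1 (trace_mul_nonneg hM.posSemidef hB)
      apply Complex.ext
      · rw [← heq]; simp
      · exact h1.2.symm
    have h2 := cancel _ _ (mul_eq_zero_of_trace_eq_zero hM.posSemidef hB h0)
    simpa using h2
  have hQ := posSemidef_sub_vecMulVec hM hh
  set κ : ℝ := rxPower h M⁻¹ with hκ
  have hκ0 : κ ≠ 0 := (rxPower_pos hh hM.inv).ne'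
  have h0 : ((M - ((κ⁻¹ : ℝ) : ℂ) • vecMulVec h (star h)) * B).trace = 0 := by
    have h1 := Complex.le_def.1 (trace_mul_nonneg hQ hB)
    apply Complex.ext
    · rw [re_trace_sub_vecMulVec_mul, ← heq]
      simp [div_eq_inv_mul]
    · exact h1.2.symm
  have h2 := mul_eq_zero_of_trace_eq_zero hQ hB h0
  rw [Matrix.sub_mul, sub_eq_zero] at h2
  set u := M⁻¹ *ᵥ h with hu
  set c : ℂ := ((κ⁻¹ : ℝ) : ℂ) with hc
  have hcs : star c = c := Complex.conj_ofReal _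
  have h3 : B = c • vecMulVec u (star (B *ᵥ h)) := by
    conv_lhs => rw [cancel _ _ h2]
    rw [Matrix.smul_mul, vecMulVec_mul, Matrix.mul_smul, mul_vecMulVec, star_mulVec, hB.1.eq]
  have h4 : B *ᵥ h = (c * (rxPower h B : ℂ)) • u := by
    have h5 : B = c • vecMulVec (B *ᵥ h) (star u) := by
      conv_lhs => rw [← hB.1.eq, h3]
      rw [conjTranspose_smul, conjTranspose_vecMulVec, star_star, hcs]
    conv_lhs => rw [h3]
    rw [smul_mulVec, vecMulVec_mulVec, star_mulVec, hB.1.eq, ← dotProduct_mulVec,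
      ← coe_rxPower h hB, mul_smul]
    simp
  conv_lhs => rw [h3, h4, star_smul, vecMulVec_smul, smul_smul]
  congr 1
  simp [hc]
  field_simp

/-! ### Rank-one updates -/

lemma det_add_vecMulVec {M : Matrix ι ι ℂ} (hM : M.PosDef) (p : ℝ) (h : ι → ℂ) :
    (M + (p : ℂ) • vecMulVec h (star h)).det = M.det * (1 + p * rxPower h M⁻¹ : ℝ) := by
  have h1 : (p : ℂ) • vecMulVec h (star h)
      = replicateCol Unit ((p : ℂ) • h) * replicateRow Unit (star h) := by
    rw [← vecMulVec_eq, smul_vecMulVec]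
  rw [h1, det_add_replicateCol_mul_replicateRow ((isUnit_iff_isUnit_det _).1 hM.isUnit)]
  congr 1
  rw [det_unique]
  have := coe_rxPower h hM.inv.posSemidef
  push_cast
  rw [this]
  simp only [Matrix.add_apply, one_apply_eq, Matrix.mul_assoc]
  congr 1
  rw [← replicateCol_mulVec]
  simp [mul_apply, replicateRow_apply, replicateCol_apply, dotProduct, mulVec_smul,
    Finset.mul_sum, mul_left_comm]

lemma det_re_pos {M : Matrix ι ι ℂ} (hM : M.PosDef) : 0 < M.det.re :=
  (Complex.lt_def.1 hM.det_pos).1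

lemma coe_det_re {M : Matrix ι ι ℂ} (hM : M.PosDef) : (M.det.re : ℂ) = M.det := by
  apply Complex.ext
  · rfl
  · exact (Complex.lt_def.1 hM.det_pos).2

lemma det_re_add_vecMulVec {M : Matrix ι ι ℂ} (hM : M.PosDef) (p : ℝ) (h : ι → ℂ) :
    (M + (p : ℂ) • vecMulVec h (star h)).det.re = M.det.re * (1 + p * rxPower h M⁻¹) := by
  rw [det_add_vecMulVec hM, Complex.re_mul_ofReal]

/-- The Sherman-Morrison formula, applied to a vector. -/
lemma inv_mulVec_sub_inv_add_vecMulVec_mulVec {M : Matrix ι ι ℂ} (hM : M.PosDef) {x : ℝ}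
    (hx : 0 ≤ x) (a b : ι → ℂ) :
    M⁻¹ *ᵥ b - (M + (x : ℂ) • vecMulVec a (star a))⁻¹ *ᵥ b
      = ((x : ℂ) * (star a ⬝ᵥ (M⁻¹ *ᵥ b)) / (1 + x * rxPower a M⁻¹ : ℝ)) • (M⁻¹ *ᵥ a) := by
  have hN := posDef_add_vecMulVec hM hx a
  set N := M + (x : ℂ) • vecMulVec a (star a) with hNdef
  have iM : Invertible M := hM.isUnit.invertible
  have iN : Invertible N := hN.isUnit.invertible
  have hpos : 0 < 1 + x * rxPower a M⁻¹ := by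
    have := rxPower_nonneg a hM.inv.posSemidef
    positivity
  have hne : ((1 + x * rxPower a M⁻¹ : ℝ) : ℂ) ≠ 0 := by exact_mod_cast hpos.ne'
  have hκ := coe_rxPower a hM.inv.posSemidef
  have inj : ∀ v w : ι → ℂ, N *ᵥ v = N *ᵥ w → v = w := by
    intro v w hvw
    have := congrArg (N⁻¹ *ᵥ ·) hvw
    simpa [mulVec_mulVec] using this
  apply inj
  rw [mulVec_sub, mulVec_smul]
  have e : ∀ v, N *ᵥ (M⁻¹ *ᵥ v) = v + ((x : ℂ) * (star a ⬝ᵥ (M⁻¹ *ᵥ v))) • a := by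
    intro v
    rw [hNdef, add_mulVec, mul_inv_mulVec hM, smul_mulVec, vecMulVec_mulVec]
    simp [smul_smul]
  rw [e, e, ← hκ, mul_inv_mulVec hN, add_sub_cancel_left]
  funext i
  simp only [Pi.smul_apply, Pi.add_apply, smul_eq_mul]
  push_cast at hne ⊢
  field_simp

/-- The explicit loss of gain caused by one more interferer shows when nothing is lost: its power is
zero or the two channels are orthogonal with respect to `M⁻¹`. -/
lemma rxPower_inv_sub_rxPower_inv_add {M : Matrix ι ι ℂ} (hM : M.PosDef) {x : ℝ}
    (hx : 0 ≤ x) (a b : ι → ℂ) :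
    rxPower b M⁻¹ - rxPower b (M + (x : ℂ) • vecMulVec a (star a))⁻¹
      = x * ‖star a ⬝ᵥ (M⁻¹ *ᵥ b)‖ ^ 2 / (1 + x * rxPower a M⁻¹) := by
  have h1 := congrArg (fun v => (star b ⬝ᵥ v).re)
    (inv_mulVec_sub_inv_add_vecMulVec_mulVec hM hx a b)
  simp only [dotProduct_sub, Complex.sub_re, dotProduct_smul] at h1
  rw [rxPower, rxPower, h1, ← star_dotProduct_mulVec hM.inv.1 a b]
  set z := star a ⬝ᵥ (M⁻¹ *ᵥ b)
  rw [smul_eq_mul]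
  have : (x : ℂ) * z / ((1 + x * rxPower a M⁻¹ : ℝ) : ℂ) * star z
      = ((x * ‖z‖ ^ 2 / (1 + x * rxPower a M⁻¹) : ℝ) : ℂ) := by
    push_cast
    rw [← Complex.mul_conj' z]
    simp only [RCLike.star_def]
    ring
  rw [this, Complex.ofReal_re]

end QuadraticForm

/-! ### Strict concavity of the log-determinant -/

section LogDet

variable {ι : Type*} [Fintype ι] [DecidableEq ι]

/-- Sum `log e ≤ e - 1` over the eigenvalues; equality forces every eigenvalue to be `1`. -/
lemma log_det_le_trace_sub {Z : Matrix ι ι ℂ} (hZ : Z.PosDef) :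
    Real.log Z.det.re ≤ Z.trace.re - Fintype.card ι ∧
      (Real.log Z.det.re = Z.trace.re - Fintype.card ι → Z = 1) := by
  have hpos := hZ.eigenvalues_pos
  set e := hZ.1.eigenvalues with he
  have hdet : Z.det.re = ∏ i, e i := by
    rw [hZ.1.det_eq_prod_eigenvalues]
    simp only [Complex.coe_algebraMap, ← Complex.ofReal_prod]
    exact Complex.ofReal_re _
  have htr : Z.trace.re = ∑ i, e i := by
    rw [hZ.1.trace_eq_sum_eigenvalues]
    simp [he]
  have hlog : Real.log Z.det.re = ∑ i, Real.log (e i) := by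
    rw [hdet, Real.log_prod (fun i _ => (hpos i).ne')]
  have hsum : Z.trace.re - Fintype.card ι = ∑ i, (e i - 1) := by
    rw [htr, Finset.sum_sub_distrib]; simp
  rw [hlog, hsum]
  refine ⟨Finset.sum_le_sum fun i _ => Real.log_le_sub_one_of_pos (hpos i), fun heq => ?_⟩
  rw [Finset.sum_eq_sum_iff_of_le fun i _ => Real.log_le_sub_one_of_pos (hpos i)] at heq
  have h1 : ∀ i, e i = 1 := by
    intro i
    by_contra hne
    exact (Real.log_lt_sub_one_of_pos (hpos i) hne).ne (heq i (Finset.mem_univ i))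
  have h2 := hZ.1.spectral_theorem
  have h3 : (RCLike.ofReal ∘ hZ.1.eigenvalues : ι → ℂ) = fun _ => 1 := by
    funext i
    simp [← he, h1 i]
  rw [h3] at h2
  rw [h2]
  simp

/-- The tangent bound for the log-determinant. -/
lemma log_det_le_tangent {X Y : Matrix ι ι ℂ} (hX : X.PosDef) (hY : Y.PosDef) :
    Real.log Y.det.re ≤ Real.log X.det.re + (X⁻¹ * (Y - X)).trace.re ∧
      (Real.log Y.det.re = Real.log X.det.re + (X⁻¹ * (Y - X)).trace.re → Y = X) := by
  -- Factoring `X⁻¹ = Cᴴ C` moves the base point to the identity: the previous bound is applied to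
  -- `C Y Cᴴ`.
  obtain ⟨C, hC⟩ := exists_conjTranspose_mul_self hX.inv.posSemidef
  have iX : Invertible X := hX.isUnit.invertible
  have hCu : IsUnit C := by
    have : IsUnit (Cᴴ * C) := hC ▸ hX.inv.isUnit
    rw [isUnit_iff_isUnit_det, det_mul] at this
    exact (isUnit_iff_isUnit_det _).2 (isUnit_of_mul_isUnit_right this)
  have hZ : (C * Y * Cᴴ).PosDef := by
    have := (Matrix.IsUnit.posDef_star_right_conjugate_iff hCu (x := Y)).2 hY
    exact this
  have htr : (C * Y * Cᴴ).trace.re - Fintype.card ι = (X⁻¹ * (Y - X)).trace.re := by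
    rw [Matrix.mul_sub, Matrix.inv_mul_of_invertible, trace_sub, trace_one, trace_mul_comm,
      ← Matrix.mul_assoc, ← hC]
    simp
  have hdet : Real.log (C * Y * Cᴴ).det.re = Real.log Y.det.re - Real.log X.det.re := by
    have h1 : (C * Y * Cᴴ).det = X⁻¹.det * Y.det := by
      rw [hC]; simp only [det_mul]; ring
    have h2 : (C * Y * Cᴴ).det = ((Y.det.re / X.det.re : ℝ) : ℂ) := by
      rw [h1, det_nonsing_inv, Ring.inverse_eq_inv', Complex.ofReal_div, coe_det_re hX,
        coe_det_re hY]
      ring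
    rw [h2, Complex.ofReal_re, Real.log_div (det_re_pos hY).ne' (det_re_pos hX).ne']
  obtain ⟨h1, h2⟩ := log_det_le_trace_sub hZ
  rw [htr, hdet] at h1 h2
  refine ⟨by linarith, fun heq => ?_⟩
  have h3 := h2 (by linarith)
  have h4 : Cᴴ * (C * Y * Cᴴ) * C = Cᴴ * C := by rw [h3, Matrix.mul_one]
  rw [show Cᴴ * (C * Y * Cᴴ) * C = (Cᴴ * C) * Y * (Cᴴ * C) by simp only [Matrix.mul_assoc],
    ← hC] at h4
  have h5 := congrArg (fun Z => X * Z * X) h4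
  simpa [Matrix.mul_assoc] using h5

/-- Add the tangent bounds at the midpoint: their linear terms cancel. -/
lemma log_det_midpoint {X Y Z : Matrix ι ι ℂ} (hX : X.PosDef) (hY : Y.PosDef) (hZ : Z.PosDef)
    (hmid : X + Y = Z + Z) :
    Real.log X.det.re + Real.log Y.det.re ≤ 2 * Real.log Z.det.re ∧
      (Real.log X.det.re + Real.log Y.det.re = 2 * Real.log Z.det.re → X = Y) := by
  obtain ⟨h1, h1'⟩ := log_det_le_tangent hZ hX
  obtain ⟨h2, h2'⟩ := log_det_le_tangent hZ hY
  have h0 : (Z⁻¹ * (X - Z)).trace.re + (Z⁻¹ * (Y - Z)).trace.re = 0 := by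
    rw [← Complex.add_re, ← trace_add, ← Matrix.mul_add,
      show X - Z + (Y - Z) = 0 by rw [sub_add_sub_comm, hmid, sub_self]]
    simp
  refine ⟨by linarith, fun heq => ?_⟩
  rw [h1' (by linarith), h2' (by linarith)]

end LogDet

end MISOBC

/-! ### Duality between the broadcast and the multiple access channel. -/

namespace MISOBC

open Matrix

lemma exists_fixed_of_wellFounded {κ : Type*} {r : κ → κ → Prop} (wf : WellFounded r)
    (F : κ → (κ → ℝ) → ℝ)
    (hF : ∀ i g g', (∀ k, r k i → g k = g' k) → F i g = F i g') : ∃ g, ∀ i, g i = F i g := by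
  classical
  -- The default `0` outside the predecessors is never seen, because `F i` reads only predecessors.
  refine ⟨wf.fix fun i rec => F i fun k => if hk : r k i then rec k hk else 0, fun i => ?_⟩
  rw [wf.fix_eq]
  exact hF _ _ _ fun k hk => by simp [hk]

lemma macCov_insert {ι : Type*} {K : ℕ} (A : Matrix ι ι ℂ) (h : Fin K → ι → ℂ) (π : Equiv.Perm (Fin K))
    (p : Fin K → ℝ) {s : Finset (Fin K)} {i : Fin K} (hi : i ∉ s) :
    macCov A h π p (insert i s)
      = macCov A h π p s + (p (π i) : ℂ) • vecMulVec (h (π i)) (star (h (π i))) := by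
  rw [macCov, macCov, Finset.sum_insert hi]
  abel

lemma macCov_Iic {ι : Type*} {K : ℕ} (A : Matrix ι ι ℂ) (h : Fin K → ι → ℂ) (π : Equiv.Perm (Fin K))
    (p : Fin K → ℝ) (i : Fin K) :
    macCov A h π p (Finset.Iic i)
      = macCov A h π p (Finset.Iio i) + (p (π i) : ℂ) • vecMulVec (h (π i)) (star (h (π i))) := by
  rw [← Finset.Iio_insert, macCov_insert _ _ _ _ (by simp)]

section Rates

variable {ι : Type*} [Fintype ι] {K : ℕ}

lemma posDef_macCov {A : Matrix ι ι ℂ} (hA : A.PosDef) (h : Fin K → ι → ℂ)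
    (π : Equiv.Perm (Fin K)) {p : Fin K → ℝ} (hp : ∀ i, 0 ≤ p i) (s : Finset (Fin K)) :
    (macCov A h π p s).PosDef :=
  hA.add_posSemidef (posSemidef_sum _ fun k _ => posSemidef_smul_vecMulVec (hp (π k)) _)

lemma re_trace_macCov_mul (A : Matrix ι ι ℂ) (h : Fin K → ι → ℂ) (π : Equiv.Perm (Fin K))
    (p : Fin K → ℝ) (s : Finset (Fin K)) (S : Matrix ι ι ℂ) :
    (macCov A h π p s * S).trace.re
      = (A * S).trace.re + ∑ k ∈ s, p (π k) * rxPower (h (π k)) S := by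
  rw [macCov, Matrix.add_mul, trace_add, Complex.add_re, Matrix.sum_mul, trace_sum,
    Complex.re_sum]
  congr 1
  refine Finset.sum_congr rfl fun k _ => ?_
  rw [Matrix.smul_mul, trace_smul, trace_vecMulVec_mul]
  simp [rxPower]

/-- Noise plus interference of the user at position `i` of the broadcast channel. -/
noncomputable def bcNoise (nv : ℝ) (h : Fin K → ι → ℂ) (S : Fin K → Matrix ι ι ℂ) (π : Equiv.Perm (Fin K))
    (i : Fin K) : ℝ :=
  nv + rxPower (h (π i)) (∑ k ∈ Finset.Ioi i, S (π k))

lemma bcNoise_eq (nv : ℝ) (h : Fin K → ι → ℂ) (S : Fin K → Matrix ι ι ℂ)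
    (π : Equiv.Perm (Fin K)) (i : Fin K) :
    bcNoise nv h S π i = nv + ∑ k ∈ Finset.Ioi i, rxPower (h (π i)) (S (π k)) := by
  rw [bcNoise, rxPower_sum]

lemma bcNoise_pos {nv : ℝ} (hnv : 0 < nv) (h : Fin K → ι → ℂ) {S : Fin K → Matrix ι ι ℂ}
    (hS : ∀ i, (S i).PosSemidef) (π : Equiv.Perm (Fin K)) (i : Fin K) :
    0 < bcNoise nv h S π i :=
  add_pos_of_pos_of_nonneg hnv (rxPower_nonneg _ (posSemidef_sum _ fun _ _ => hS _))

lemma dpcRate_eq {nv : ℝ} (hnv : 0 < nv) (h : Fin K → ι → ℂ) {S : Fin K → Matrix ι ι ℂ}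
    (hS : ∀ i, (S i).PosSemidef) (π : Equiv.Perm (Fin K)) (i : Fin K) :
    dpcRate nv h S π i = Real.logb 2 (1 + rxPower (h (π i)) (S (π i)) / bcNoise nv h S π i) := by
  have hpos := bcNoise_pos hnv h hS π i
  rw [dpcRate, ← Finset.Ioi_insert, Finset.sum_insert (by simp), rxPower_add]
  congr 1
  rw [bcNoise] at hpos ⊢
  field_simp
  ring

/-- Exchanging the order of summation cancels the interference in the broadcast channel
against that in the dual channel. -/
lemma sum_trace_sub_sum_noise (nv : ℝ) (A : Matrix ι ι ℂ) (h : Fin K → ι → ℂ)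
    (S : Fin K → Matrix ι ι ℂ) (π : Equiv.Perm (Fin K)) (p : Fin K → ℝ) :
    ∑ i, (macCov A h π p (Finset.Iio i) * S (π i)).trace.re
        - ∑ i, p (π i) * bcNoise nv h S π i
      = (∑ i, (A * S i).trace).re - nv * ∑ i, p i := by
  have hcomm : ∑ i, ∑ k ∈ Finset.Iio i, p (π k) * rxPower (h (π k)) (S (π i))
      = ∑ i, ∑ k ∈ Finset.Ioi i, p (π i) * rxPower (h (π i)) (S (π k)) :=
    Finset.sum_comm' (by simp)
  simp only [re_trace_macCov_mul, bcNoise_eq, mul_add, Finset.mul_sum, Finset.sum_add_distrib,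
    Complex.re_sum, hcomm]
  rw [Equiv.sum_comp π fun i => (A * S i).trace.re, Equiv.sum_comp π fun i => p i * nv]
  simp only [mul_comm nv]
  ring

lemma rxPower_smul_left (c : ℝ) (w : ι → ℂ) (M : Matrix ι ι ℂ) :
    rxPower ((c : ℂ) • w) M = c ^ 2 * rxPower w M := by
  simp [rxPower, mulVec_smul, dotProduct_smul, smul_dotProduct, star_smul]
  ring

lemma vecMulVec_ofReal_smul (c : ℝ) (w : ι → ℂ) :
    vecMulVec ((c : ℂ) • w) (star ((c : ℂ) • w)) = ((c ^ 2 : ℝ) : ℂ) • vecMulVec w (star w) := by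
  rw [star_smul, vecMulVec_smul, smul_vecMulVec, smul_smul]
  congr 1
  simp [sq]

variable [DecidableEq ι]

/-- The gain `hᴴ M⁻¹ h` of the user at position `i` of the dual multiple access channel. -/
noncomputable def macGain (A : Matrix ι ι ℂ) (h : Fin K → ι → ℂ) (π : Equiv.Perm (Fin K)) (p : Fin K → ℝ)
    (i : Fin K) : ℝ :=
  rxPower (h (π i)) (macCov A h π p (Finset.Iio i))⁻¹

lemma macGain_nonneg {A : Matrix ι ι ℂ} (hA : A.PosDef) (h : Fin K → ι → ℂ)
    (π : Equiv.Perm (Fin K)) {p : Fin K → ℝ} (hp : ∀ i, 0 ≤ p i) (i : Fin K) :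
    0 ≤ macGain A h π p i :=
  rxPower_nonneg _ (posDef_macCov hA h π hp _).inv.posSemidef

lemma eq_zero_of_macGain_eq_zero {A : Matrix ι ι ℂ} (hA : A.PosDef) {h : Fin K → ι → ℂ}
    {π : Equiv.Perm (Fin K)} {p : Fin K → ℝ} (hp : ∀ i, 0 ≤ p i) {i : Fin K}
    (h0 : macGain A h π p i = 0) : h (π i) = 0 :=
  rxPower_eq_zero_of_eq_zero (posDef_macCov hA h π hp _).inv h0

lemma macRateAt_eq {A : Matrix ι ι ℂ} (hA : A.PosDef) (h : Fin K → ι → ℂ)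
    (π : Equiv.Perm (Fin K)) {p : Fin K → ℝ} (hp : ∀ i, 0 ≤ p i) (i : Fin K) :
    macRateAt A h π p i = Real.logb 2 (1 + p (π i) * macGain A h π p i) := by
  have hM := posDef_macCov hA h π hp (Finset.Iio i)
  have := (det_re_pos hM).ne'
  rw [macRateAt, macCov_Iic, det_re_add_vecMulVec hM, macGain, mul_div_cancel_left₀ _ this]

lemma one_add_mul_macGain_pos {A : Matrix ι ι ℂ} (hA : A.PosDef) (h : Fin K → ι → ℂ)
    (π : Equiv.Perm (Fin K)) {p : Fin K → ℝ} (hp : ∀ i, 0 ≤ p i) (i : Fin K) :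
    0 < 1 + p (π i) * macGain A h π p i := by
  have := mul_nonneg (hp (π i)) (macGain_nonneg hA h π hp i)
  positivity

lemma two_rpow_macRateAt_sub_one {A : Matrix ι ι ℂ} (hA : A.PosDef) (h : Fin K → ι → ℂ)
    (π : Equiv.Perm (Fin K)) {p : Fin K → ℝ} (hp : ∀ i, 0 ≤ p i) (i : Fin K) :
    (2 : ℝ) ^ macRateAt A h π p i - 1 = p (π i) * macGain A h π p i := by
  rw [macRateAt_eq hA h π hp,
    Real.rpow_logb two_pos (by norm_num) (one_add_mul_macGain_pos hA h π hp i)]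
  ring

lemma macRateAt_nonneg {A : Matrix ι ι ℂ} (hA : A.PosDef) (h : Fin K → ι → ℂ)
    (π : Equiv.Perm (Fin K)) {p : Fin K → ℝ} (hp : ∀ i, 0 ≤ p i) (i : Fin K) :
    0 ≤ macRateAt A h π p i := by
  rw [macRateAt_eq hA h π hp]
  apply Real.logb_nonneg one_lt_two
  have := mul_nonneg (hp (π i)) (macGain_nonneg hA h π hp i)
  linarith

/-- From the broadcast channel to the dual multiple access channel: the same rates can be
obtained without more power, and power is saved unless all covariances are beams along the
MMSE receivers. -/
theorem exists_mac_of_bc {nv : ℝ} (hnv : 0 < nv) {A : Matrix ι ι ℂ} (hA : A.PosDef)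
    (h : Fin K → ι → ℂ) {S : Fin K → Matrix ι ι ℂ} (hS : ∀ i, (S i).PosSemidef)
    (π : Equiv.Perm (Fin K)) :
    ∃ p : Fin K → ℝ, (∀ i, 0 ≤ p i) ∧ nv * ∑ i, p i ≤ (∑ i, (A * S i).trace).re ∧
      (∀ i, macRateAt A h π p i = dpcRate nv h S π i) ∧
      (nv * ∑ i, p i = (∑ i, (A * S i).trace).re → ∀ i,
        S (π i) = ((p (π i) * bcNoise nv h S π i / macGain A h π p i : ℝ) : ℂ) •
          vecMulVec ((macCov A h π p (Finset.Iio i))⁻¹ *ᵥ h (π i))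
            (star ((macCov A h π p (Finset.Iio i))⁻¹ *ᵥ h (π i)))) := by
  have hs : ∀ i, 0 ≤ rxPower (h (π i)) (S (π i)) := fun i => rxPower_nonneg _ (hS _)
  have hc : ∀ i, 0 < bcNoise nv h S π i := bcNoise_pos hnv h hS π
  -- The dual power of a user depends on the earlier ones through its gain. The absolute value
  -- avoids a circle: the gain is known to be nonnegative only once the powers are. It is removed in
  -- `hpi`.
  obtain ⟨g, hg⟩ := exists_fixed_of_wellFounded (κ := Fin K) (r := (· < ·)) wellFounded_lt
    (fun i g => |rxPower (h (π i)) (S (π i)) /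
      (bcNoise nv h S π i * macGain A h π (g ∘ π.symm) i)|) (by
        intro i g g' hgg
        have : macGain A h π (g ∘ π.symm) i = macGain A h π (g' ∘ π.symm) i := by
          unfold macGain macCov
          congr 3
          refine Finset.sum_congr rfl fun k hk => ?_
          simp [hgg k (Finset.mem_Iio.1 hk)]
        simp only [this])
  set p := g ∘ π.symm with hpdef
  have hp : ∀ i, 0 ≤ p i := by
    intro i
    rw [hpdef, Function.comp_apply, hg]
    exact abs_nonneg _
  have hκ := macGain_nonneg hA h π hp
  have hpi : ∀ i, p (π i) = rxPower (h (π i)) (S (π i)) /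
      (bcNoise nv h S π i * macGain A h π p i) := by
    intro i
    have : p (π i) = g i := by simp [hpdef]
    rw [this, hg, abs_of_nonneg (div_nonneg (hs i) (mul_nonneg (hc i).le (hκ i)))]
  have hpc : ∀ i, p (π i) * bcNoise nv h S π i
      = rxPower (h (π i)) (S (π i)) / macGain A h π p i := by
    intro i
    have := (hc i).ne'
    rw [hpi]
    field_simp
  have hrate : ∀ i, p (π i) * macGain A h π p i
      = rxPower (h (π i)) (S (π i)) / bcNoise nv h S π i := by
    intro i
    have := (hc i).ne'
    by_cases h0 : macGain A h π p i = 0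
    -- Zero gain means zero channel, so the division by zero in the definition of `p` is harmless:
    -- both sides vanish.
    · simp [h0, eq_zero_of_macGain_eq_zero hA hp h0]
    · rw [hpi]
      field_simp
  have hle : ∀ i ∈ Finset.univ, p (π i) * bcNoise nv h S π i
      ≤ (macCov A h π p (Finset.Iio i) * S (π i)).trace.re := by
    intro i _
    rw [hpc]
    exact rxPower_div_le_trace (posDef_macCov hA h π hp _) (hS _) _
  have hbal := sum_trace_sub_sum_noise nv A h S π p
  refine ⟨p, hp, ?_, ?_, ?_⟩
  · have := Finset.sum_le_sum hle
    linarith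
  · intro i
    rw [macRateAt_eq hA h π hp, dpcRate_eq hnv h hS, hrate]
  · intro heq i
    have h1 := (Finset.sum_eq_sum_iff_of_le hle).1 (by linarith) i (Finset.mem_univ i)
    rw [hpc] at h1 ⊢
    exact eq_vecMulVec_of_rxPower_div_eq_trace (posDef_macCov hA h π hp _) (hS _) _ h1

/-! ### From the multiple access channel to the broadcast channel -/

lemma beamCov_eq (A : Matrix ι ι ℂ) (h : Fin K → ι → ℂ) (π : Equiv.Perm (Fin K))
    (p : Fin K → ℝ) {q : Fin K → ℝ} (hq : ∀ i, 0 ≤ q i) (j : Fin K) :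
    beamCov A h π p q j
      = (q j : ℂ) • vecMulVec (mmseBeam A h π p j) (star (mmseBeam A h π p j)) := by
  rw [beamCov]
  rw [vecMulVec_ofReal_smul, Real.sq_sqrt (hq j)]

lemma posSemidef_beamCov (A : Matrix ι ι ℂ) (h : Fin K → ι → ℂ) (π : Equiv.Perm (Fin K))
    (p q : Fin K → ℝ) (j : Fin K) : (beamCov A h π p q j).PosSemidef :=
  posSemidef_vecMulVec_self_star _

lemma rxPower_beamCov (A : Matrix ι ι ℂ) (h : Fin K → ι → ℂ) (π : Equiv.Perm (Fin K))
    (p : Fin K → ℝ) {q : Fin K → ℝ} (hq : ∀ i, 0 ≤ q i) (j : Fin K) (g : ι → ℂ) :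
    rxPower g (beamCov A h π p q j) = q j * ‖star g ⬝ᵥ mmseBeam A h π p j‖ ^ 2 := by
  rw [beamCov_eq A h π p hq, rxPower_smul, rxPower_vecMulVec]

/-- The beams along `M⁻¹ h` are the equality case of Cauchy–Schwarz, so the power balance is tight.
Only users with zero channel can make it strict, since their dual power buys no downlink power. -/
theorem exists_isDownlinkPower {nv : ℝ} (hnv : 0 < nv) {A : Matrix ι ι ℂ} (hA : A.PosDef)
    (h : Fin K → ι → ℂ) (π : Equiv.Perm (Fin K)) {p : Fin K → ℝ} (hp : ∀ i, 0 ≤ p i) :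
    ∃ q : Fin K → ℝ, (∀ i, 0 ≤ q i) ∧ IsDownlinkPower nv A h π p q ∧
      (∀ i, dpcRate nv h (beamCov A h π p q) π i = macRateAt A h π p i) ∧
      (∑ i, (A * beamCov A h π p q i).trace).re ≤ nv * ∑ i, p i := by
  have hg0 := macGain_nonneg hA h π hp
  -- The recursion runs backwards, since only users encoded later interfere; absolute values again
  -- give nonnegativity for free.
  obtain ⟨g, hg⟩ := exists_fixed_of_wellFounded (κ := Fin K) (r := (· > ·)) wellFounded_gt
    (fun i g => |((2 : ℝ) ^ macRateAt A h π p i - 1) /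
      ‖star (h (π i)) ⬝ᵥ mmseBeam A h π p (π i)‖ ^ 2 *
      (∑ k ∈ Finset.Ioi i, |g k| * ‖star (h (π i)) ⬝ᵥ mmseBeam A h π p (π k)‖ ^ 2 + nv)|) (by
        intro i g g' hgg
        have : ∀ k ∈ Finset.Ioi i, |g k| * ‖star (h (π i)) ⬝ᵥ mmseBeam A h π p (π k)‖ ^ 2
            = |g' k| * ‖star (h (π i)) ⬝ᵥ mmseBeam A h π p (π k)‖ ^ 2 := fun k hk => by
          rw [hgg k (Finset.mem_Ioi.1 hk)]
        simp only [Finset.sum_congr rfl this])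
  have hgn : ∀ i, 0 ≤ g i := fun i => by rw [hg]; exact abs_nonneg _
  have hq : ∀ i, 0 ≤ (g ∘ π.symm) i := fun i => hgn _
  have hdown : IsDownlinkPower nv A h π p (g ∘ π.symm) := by
    intro i
    simp only [Function.comp_apply, Equiv.symm_apply_apply]
    rw [hg i, abs_of_nonneg]
    · simp only [abs_of_nonneg (hgn _)]
    · rw [two_rpow_macRateAt_sub_one hA h π hp]
      refine mul_nonneg (div_nonneg (mul_nonneg (hp _) (hg0 i)) (sq_nonneg _)) (add_nonneg
        (Finset.sum_nonneg fun k _ => mul_nonneg (abs_nonneg _) (sq_nonneg _)) hnv.le)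
  set q := g ∘ π.symm
  have hB := posSemidef_beamCov A h π p q
  have hnoise : ∀ i, bcNoise nv h (beamCov A h π p q) π i
      = ∑ k ∈ Finset.Ioi i, q (π k) * ‖star (h (π i)) ⬝ᵥ mmseBeam A h π p (π k)‖ ^ 2 + nv := by
    intro i
    rw [bcNoise_eq, add_comm]
    simp only [rxPower_beamCov A h π p hq]
  have hc := bcNoise_pos hnv h hB π
  have hqi : ∀ i, q (π i) = p (π i) * macGain A h π p i /
      ‖star (h (π i)) ⬝ᵥ mmseBeam A h π p (π i)‖ ^ 2 * bcNoise nv h (beamCov A h π p q) π i := by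
    intro i
    rw [hdown i, two_rpow_macRateAt_sub_one hA h π hp, hnoise]
  have hbeam : ∀ i, mmseBeam A h π p (π i)
      = ((‖WithLp.toLp 2 ((macCov A h π p (Finset.Iio i))⁻¹ *ᵥ h (π i))‖⁻¹ : ℝ) : ℂ) •
        ((macCov A h π p (Finset.Iio i))⁻¹ *ᵥ h (π i)) := by
    intro i
    simp [mmseBeam]
  -- Here `t` is the normalizing factor of the beam, which cancels from both rate and power.
  have key : ∀ i, macGain A h π p i ≠ 0 → ∃ t : ℝ, t ≠ 0 ∧
      ‖star (h (π i)) ⬝ᵥ mmseBeam A h π p (π i)‖ ^ 2 = t ^ 2 * macGain A h π p i ^ 2 ∧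
      rxPower (mmseBeam A h π p (π i)) (macCov A h π p (Finset.Iio i))
        = t ^ 2 * macGain A h π p i := by
    intro i hi
    have hM := posDef_macCov hA h π hp (Finset.Iio i)
    set u := (macCov A h π p (Finset.Iio i))⁻¹ *ᵥ h (π i) with hu
    have hκ : star (h (π i)) ⬝ᵥ u = (macGain A h π p i : ℂ) :=
      (coe_rxPower _ hM.inv.posSemidef).symm
    refine ⟨‖WithLp.toLp 2 u‖⁻¹, ?_, ?_, ?_⟩
    · intro h0
      rw [inv_eq_zero, norm_eq_zero] at h0
      have h1 : u = 0 := by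
        have := congrArg WithLp.ofLp h0
        simpa using this
      rw [h1, dotProduct_zero] at hκ
      exact hi (by exact_mod_cast hκ.symm)
    · rw [hbeam, ← hu, dotProduct_smul, hκ, smul_eq_mul, norm_mul, Complex.norm_real,
        Complex.norm_real, mul_pow, Real.norm_eq_abs, Real.norm_eq_abs, sq_abs, sq_abs]
    · rw [hbeam, ← hu, rxPower_smul_left]
      congr 1
      rw [rxPower, hu, mul_inv_mulVec hM, ← hu, star_dotProduct, hκ]
      simp
  refine ⟨q, hq, hdown, ?_, ?_⟩
  · intro i
    rw [macRateAt_eq hA h π hp, dpcRate_eq hnv h hB, rxPower_beamCov A h π p hq]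
    congr 2
    by_cases h0 : macGain A h π p i = 0
    · simp [h0, eq_zero_of_macGain_eq_zero hA hp h0]
    · obtain ⟨t, ht, h1, -⟩ := key i h0
      have := (hc i).ne'
      rw [hqi, h1]
      field_simp
  · have hle : ∀ i ∈ Finset.univ,
        (macCov A h π p (Finset.Iio i) * beamCov A h π p q (π i)).trace.re
          ≤ p (π i) * bcNoise nv h (beamCov A h π p q) π i := by
      intro i _
      rw [beamCov_eq A h π p hq, Matrix.mul_smul, trace_smul, smul_eq_mul,
        Complex.re_ofReal_mul, re_trace_mul_vecMulVec]
      by_cases h0 : macGain A h π p i = 0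
      · rw [hqi, h0]
        simpa using mul_nonneg (hp _) (hc i).le
      · obtain ⟨t, ht, h1, h2⟩ := key i h0
        rw [hqi, h1, h2]
        apply le_of_eq
        field_simp
    have := Finset.sum_le_sum hle
    have hbal := sum_trace_sub_sum_noise nv A h (beamCov A h π p q) π p
    linarith

end Rates

end MISOBC

/-! ### Exchanging neighbours in the encoding and decoding orders. -/

namespace MISOBC

open Matrix Equiv

lemma sum_swap_of_mem_iff {κ β : Type*} [DecidableEq κ] [AddCommMonoid β] {i j : κ}
    {s : Finset κ} (hs : i ∈ s ↔ j ∈ s) (f : κ → β) :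
    ∑ k ∈ s, f (swap i j k) = ∑ k ∈ s, f k := by
  refine Finset.sum_equiv (swap i j) (fun k => ?_) fun _ _ => rfl
  rcases eq_or_ne k i with rfl | hi
  · rw [swap_apply_left, hs]
  rcases eq_or_ne k j with rfl | hj
  · rw [swap_apply_right, hs]
  · rw [swap_apply_of_ne_of_ne hi hj]

/-- Sorting a permutation by exchanging neighbours. -/
lemma perm_sort_induction {K : ℕ} (π : Perm (Fin K)) {Q : Perm (Fin K) → Prop}
    (hQ : ∀ (τ : Perm (Fin K)) (i j : Fin K), (i : ℕ) + 1 = j → π.symm (τ j) < π.symm (τ i) →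
      Q τ → Q (τ * swap i j)) {τ : Perm (Fin K)} (hτ : Q τ) : Q π := by
  -- `Φ` grows with every exchange that removes an inversion of `π⁻¹ τ`, so at a maximizer within
  -- `Q` there is none left; a strictly monotone permutation is the identity.
  let Φ : Perm (Fin K) → ℤ := fun τ => ∑ k : Fin K, (k : ℤ) * (π.symm (τ k) : ℕ)
  obtain ⟨⟨τ, hτ⟩, hmax⟩ := @Finite.exists_max {τ // Q τ} _ _ ⟨⟨τ, hτ⟩⟩ _ fun τ => Φ τ.1
  suffices hmono : StrictMono fun k => π.symm (τ k) by
    have h1 : (τ.trans π.symm).toOrderIso hmono.monotone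
        (by
          intro x y hxy
          rw [← hmono.le_iff_le]
          simpa using hxy) = OrderIso.refl (Fin K) := Subsingleton.elim _ _
    have h2 : τ = π := by
      ext k
      have := congrArg (fun e : Fin K ≃o Fin K => e k) h1
      have h3 : π.symm (τ k) = k := this
      rw [(Equiv.symm_apply_eq π).1 h3]
    exact h2 ▸ hτ
  have hadj : ∀ i j : Fin K, (i : ℕ) + 1 = j → π.symm (τ i) < π.symm (τ j) := by
    intro i j hij
    by_contra hlt
    have hne : i ≠ j := by
      rintro rfl
      omega
    have hlt' : π.symm (τ j) < π.symm (τ i) :=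
      lt_of_le_of_ne (not_lt.1 hlt) fun he => hne (τ.injective (π.symm.injective he)).symm
    have h1 := hmax ⟨_, hQ τ i j hij hlt' hτ⟩
    have h2 : Φ (τ * swap i j) - Φ τ = (π.symm (τ i) : ℕ) - (π.symm (τ j) : ℕ) := by
      simp only [Φ]
      rw [← Finset.sum_sub_distrib, Fintype.sum_eq_add i j hne]
      · simp only [Perm.mul_apply, swap_apply_left, swap_apply_right, ← hij]
        push_cast
        ring
      · rintro k ⟨hi, hj⟩
        simp [swap_apply_of_ne_of_ne hi hj]
    have h3 : ((π.symm (τ j) : ℕ) : ℤ) < (π.symm (τ i) : ℕ) := by exact_mod_cast hlt'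
    simp only at h1
    linarith
  cases K with
  | zero => exact fun i => i.elim0
  | succ n => exact Fin.strictMono_iff_lt_succ.2 fun i => hadj _ _ (by simp)

section Swap

variable {ι : Type*} [Fintype ι] {K : ℕ} {i j : Fin K}

lemma macCov_swap {ι : Type*} {K : ℕ} {i j : Fin K} (A : Matrix ι ι ℂ) (h : Fin K → ι → ℂ)
    (π : Perm (Fin K)) (p : Fin K → ℝ) {s : Finset (Fin K)} (hs : i ∈ s ↔ j ∈ s) :
    macCov A h (π * swap i j) p s = macCov A h π p s := by
  rw [macCov, macCov]
  congr 1
  exact sum_swap_of_mem_iff hs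
    fun k => (p (π k) : ℂ) • vecMulVec (h (π k)) (star (h (π k)))

lemma Iio_eq_Iic_of_succ (hij : (i : ℕ) + 1 = j) : Finset.Iio j = Finset.Iic i := by
  ext k
  simp only [Finset.mem_Iio, Finset.mem_Iic, Fin.lt_def, Fin.le_def]
  omega

lemma Ioi_eq_insert_of_succ (hij : (i : ℕ) + 1 = j) :
    Finset.Ioi i = insert j (Finset.Ioi j) := by
  ext k
  simp only [Finset.mem_Ioi, Finset.mem_insert, Fin.lt_def, Fin.ext_iff]
  omega

/-- The exchange only reverses who interferes with whom inside the pair. -/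
lemma bcNoise_swap (hij : (i : ℕ) + 1 = j) (nv : ℝ) (h : Fin K → ι → ℂ)
    (S : Fin K → Matrix ι ι ℂ) (π : Perm (Fin K)) :
    (∀ k, k ≠ i → k ≠ j → bcNoise nv h S (π * swap i j) k = bcNoise nv h S π k) ∧
    bcNoise nv h S π i = bcNoise nv h S (π * swap i j) j + rxPower (h (π i)) (S (π j)) ∧
    bcNoise nv h S (π * swap i j) i = bcNoise nv h S π j + rxPower (h (π j)) (S (π i)) := by
  have hne : i ≠ j := by
    rintro rfl
    omega
  refine ⟨fun k hi hj => ?_, ?_, ?_⟩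
  · have hmem : i ∈ Finset.Ioi k ↔ j ∈ Finset.Ioi k := by
      simp only [Finset.mem_Ioi, Fin.lt_def, ne_eq, Fin.ext_iff] at *
      omega
    simp only [bcNoise_eq, Perm.mul_apply, swap_apply_of_ne_of_ne hi hj]
    rw [sum_swap_of_mem_iff hmem fun l => rxPower (h (π k)) (S (π l))]
  all_goals
    have hmem : i ∈ Finset.Ioi j ↔ j ∈ Finset.Ioi j := by
      simp only [Finset.mem_Ioi, Fin.lt_def]
      omega
    simp only [bcNoise_eq, Perm.mul_apply, swap_apply_left, swap_apply_right]
  · rw [sum_swap_of_mem_iff hmem fun l => rxPower (h (π i)) (S (π l)),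
      Ioi_eq_insert_of_succ hij, Finset.sum_insert (by simp)]
    ring
  · rw [Ioi_eq_insert_of_succ hij, Finset.sum_insert (by simp),
      sum_swap_of_mem_iff hmem fun l => rxPower (h (π j)) (S (π l)), swap_apply_right]
    ring

/-- Encoding a user later never hurts it; the other user keeps its rate when it does not suffer
from the new interference. -/
lemma mem_orderRegion_swap (hij : (i : ℕ) + 1 = j) {nv : ℝ} (hnv : 0 < nv)
    {h : Fin K → ι → ℂ} {S : Fin K → Matrix ι ι ℂ} (hS : ∀ i, (S i).PosSemidef)
    {π : Perm (Fin K)}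
    (h0 : rxPower (h (π j)) (S (π j)) = 0 ∨ rxPower (h (π j)) (S (π i)) = 0)
    {r : Fin K → ℝ} (hr : r ∈ orderRegion nv h π S) :
    r ∈ orderRegion nv h (π * swap i j) S := by
  have hne : i ≠ j := by
    rintro rfl
    omega
  obtain ⟨hk, hi, hj⟩ := bcNoise_swap hij nv h S π
  refine ⟨hr.1, fun k => ?_⟩
  have key := hr.2 (swap i j k)
  rw [Perm.mul_apply]
  refine key.trans ?_
  rw [dpcRate_eq hnv h hS, dpcRate_eq hnv h hS, Perm.mul_apply]
  have hs := rxPower_nonneg (h (π (swap i j k))) (hS (π (swap i j k)))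
  have hn := bcNoise_pos hnv h hS (π * swap i j) k
  have hn' := bcNoise_pos hnv h hS π (swap i j k)
  apply Real.logb_le_logb_of_le one_lt_two (by positivity)
  gcongr 1 + ?_
  rcases eq_or_ne k i with rfl | hki
  · rw [swap_apply_left] at *
    rcases h0 with h0 | h0
    · simp [h0]
    · rw [hj, h0, add_zero]
  rcases eq_or_ne k j with rfl | hkj
  · rw [swap_apply_right] at *
    have := rxPower_nonneg (h (π i)) (hS (π k))
    gcongr
    linarith
  · rw [swap_apply_of_ne_of_ne hki hkj, hk k hki hkj]

variable [DecidableEq ι]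

/-- Exchanging two neighbours of the decoding order. -/
lemma macRate_swap (hij : (i : ℕ) + 1 = j) {A : Matrix ι ι ℂ} (hA : A.PosDef)
    (h : Fin K → ι → ℂ) (π : Perm (Fin K)) {p : Fin K → ℝ} (hp : ∀ i, 0 ≤ p i) :
    (∀ u, u ≠ π i ∧ u ≠ π j → macRate A h (π * swap i j) p u = macRate A h π p u) ∧
    macRate A h (π * swap i j) p (π i) + macRate A h (π * swap i j) p (π j)
      = macRate A h π p (π i) + macRate A h π p (π j) ∧
    macRate A h π p (π j) ≤ macRate A h (π * swap i j) p (π j) ∧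
    (macRate A h π p (π j) = macRate A h (π * swap i j) p (π j) →
      p (π i) = 0 ∨ p (π j) = 0 ∨
        star (h (π j)) ⬝ᵥ ((macCov A h π p (Finset.Iio i))⁻¹ *ᵥ h (π i)) = 0) := by
  have hne : i ≠ j := by
    rintro rfl
    omega
  have hsi : (π * swap i j).symm (π i) = j := by
    rw [Equiv.symm_apply_eq]; simp
  have hsj : (π * swap i j).symm (π j) = i := by
    rw [Equiv.symm_apply_eq]; simp
  have hIio : ∀ k, k ≠ j → macCov A h (π * swap i j) p (Finset.Iio k)
      = macCov A h π p (Finset.Iio k) := by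
    intro k hk
    apply macCov_swap
    simp only [Finset.mem_Iio, Fin.lt_def, ne_eq, Fin.ext_iff] at *
    omega
  have hIic : ∀ k, k ≠ i → macCov A h (π * swap i j) p (Finset.Iic k)
      = macCov A h π p (Finset.Iic k) := by
    intro k hk
    apply macCov_swap
    simp only [Finset.mem_Iic, Fin.le_def, ne_eq, Fin.ext_iff] at *
    omega
  have hpos : ∀ (τ : Perm (Fin K)) (s : Finset (Fin K)), 0 < (macCov A h τ p s).det.re :=
    fun τ s => det_re_pos (posDef_macCov hA h τ hp s)
  -- The rates of the pair telescope to a ratio of covariances before and after both users, which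
  -- the exchange does not touch.
  have hsum : ∀ τ : Perm (Fin K), macRateAt A h τ p i + macRateAt A h τ p j
      = Real.logb 2 ((macCov A h τ p (Finset.Iic j)).det.re /
          (macCov A h τ p (Finset.Iio i)).det.re) := by
    intro τ
    have h1 := hpos τ (Finset.Iic i)
    have h2 := hpos τ (Finset.Iic j)
    have h3 := hpos τ (Finset.Iio i)
    rw [macRateAt, macRateAt, Iio_eq_Iic_of_succ hij, ← Real.logb_mul (by positivity)
      (by positivity)]
    congr 1
    field_simp
  have hM := posDef_macCov hA h π hp (Finset.Iio i)
  have hgj : macGain A h π p j = rxPower (h (π j)) (macCov A h π p (Finset.Iio i)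
      + (p (π i) : ℂ) • vecMulVec (h (π i)) (star (h (π i))))⁻¹ := by
    rw [macGain, Iio_eq_Iic_of_succ hij, macCov_Iic]
  have hgi : macGain A h (π * swap i j) p i
      = rxPower (h (π j)) (macCov A h π p (Finset.Iio i))⁻¹ := by
    rw [macGain, hIio i hne]; simp
  -- User `π j` gains exactly by no longer seeing `π i` as interference.
  have hdiff := rxPower_inv_sub_rxPower_inv_add hM (hp (π i)) (h (π i)) (h (π j))
  have hden : 0 < 1 + p (π i) * rxPower (h (π i)) (macCov A h π p (Finset.Iio i))⁻¹ :=
    one_add_mul_macGain_pos hA h π hp i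
  have hbj : macRate A h π p (π j) = Real.logb 2 (1 + p (π j) * macGain A h π p j) := by
    rw [macRate, Equiv.symm_apply_apply, macRateAt_eq hA h π hp]
  have hbj' : macRate A h (π * swap i j) p (π j)
      = Real.logb 2 (1 + p (π j) * macGain A h (π * swap i j) p i) := by
    rw [macRate, hsj, macRateAt_eq hA h _ hp]; simp
  have hp1 := one_add_mul_macGain_pos hA h π hp j
  have hp2 := one_add_mul_macGain_pos hA h (π * swap i j) hp i
  simp only [Perm.mul_apply, swap_apply_left] at hp2
  refine ⟨?_, ?_, ?_, ?_⟩
  · rintro u ⟨hui, huj⟩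
    have hki : π.symm u ≠ i := fun hh => hui ((Equiv.symm_apply_eq π).1 hh)
    have hkj : π.symm u ≠ j := fun hh => huj ((Equiv.symm_apply_eq π).1 hh)
    have hs : (π * swap i j).symm u = π.symm u := by
      rw [Equiv.symm_apply_eq]
      simp [swap_apply_of_ne_of_ne hki hkj]
    rw [macRate, macRate, hs, macRateAt, macRateAt, hIio _ hkj, hIic _ hki]
  · rw [macRate, macRate, macRate, macRate, hsi, hsj, Equiv.symm_apply_apply,
      Equiv.symm_apply_apply, add_comm, hsum, hsum, hIio i hne, hIic j hne.symm]
  · rw [hbj, hbj']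
    apply Real.logb_le_logb_of_le one_lt_two hp1
    have := hp (π j)
    gcongr
    rw [hgj, hgi, ← sub_nonneg, hdiff]
    have := hp (π i)
    positivity
  · intro heq
    rw [hbj, hbj'] at heq
    have h1 := Real.logb_injOn_pos one_lt_two (Set.mem_Ioi.2 hp1) (Set.mem_Ioi.2 hp2) heq
    have h2 : p (π j) * (macGain A h (π * swap i j) p i - macGain A h π p j) = 0 := by
      linarith
    rw [hgj, hgi, hdiff] at h2
    have h3 : star (h (π j)) ⬝ᵥ ((macCov A h π p (Finset.Iio i))⁻¹ *ᵥ h (π i))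
        = star (star (h (π i)) ⬝ᵥ ((macCov A h π p (Finset.Iio i))⁻¹ *ᵥ h (π j))) :=
      (star_dotProduct_mulVec hM.inv.1 _ _).symm
    rw [h3, star_eq_zero]
    rcases mul_eq_zero.1 h2 with h2 | h2
    · exact Or.inr (Or.inl h2)
    rw [div_eq_zero_iff, or_iff_left hden.ne', mul_eq_zero, sq_eq_zero_iff, norm_eq_zero] at h2
    exact h2.imp_right Or.inr

lemma sum_macRate_swap_sub (hij : (i : ℕ) + 1 = j) {A : Matrix ι ι ℂ} (hA : A.PosDef)
    (h : Fin K → ι → ℂ) (π : Perm (Fin K)) {p : Fin K → ℝ} (hp : ∀ i, 0 ≤ p i)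
    (α : Fin K → ℝ) :
    ∑ u, α u * macRate A h (π * swap i j) p u - ∑ u, α u * macRate A h π p u
      = (α (π j) - α (π i)) *
        (macRate A h (π * swap i j) p (π j) - macRate A h π p (π j)) := by
  have hne : i ≠ j := by
    rintro rfl
    omega
  obtain ⟨h1, h2, -, -⟩ := macRate_swap hij hA h π hp
  rw [← Finset.sum_sub_distrib, Fintype.sum_eq_add (π i) (π j) (π.injective.ne hne)]
  · linear_combination α (π i) * h2
  · intro u hu
    rw [h1 u hu, sub_self]

/-- Among all decoding orders, those that sort the weights maximize the weighted sum rate. -/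
theorem sum_macRate_le_of_antitone {A : Matrix ι ι ℂ} (hA : A.PosDef) (h : Fin K → ι → ℂ)
    {p : Fin K → ℝ} (hp : ∀ i, 0 ≤ p i) {α : Fin K → ℝ} {π : Perm (Fin K)}
    (hπ : Antitone (α ∘ π)) (τ : Perm (Fin K)) :
    ∑ u, α u * macRate A h τ p u ≤ ∑ u, α u * macRate A h π p u := by
  refine perm_sort_induction π (Q := fun τ' => ∑ u, α u * macRate A h τ p u
    ≤ ∑ u, α u * macRate A h τ' p u) (fun τ' i j hij hlt hQ => ?_) le_rfl
  have h1 := sum_macRate_swap_sub hij hA h τ' hp α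
  have h2 := (macRate_swap hij hA h τ' hp).2.2.1
  have h3 := hπ hlt.le
  simp only [Function.comp_apply, Equiv.apply_symm_apply] at h3
  have h4 := mul_nonneg (sub_nonneg.2 h3) (sub_nonneg.2 h2)
  linarith

end Swap

end MISOBC

/-! ### The dual problem: summation by parts, existence, full power and uniqueness. -/

namespace MISOBC

open Matrix Equiv

/-- Summation by parts with antitone weights. -/
lemma sum_mul_sub_nonneg_of_antitone {K : ℕ} {a : Fin K → ℝ} (ha : Antitone a)
    (hpos : ∀ i, 0 < a i) {D : ℕ → ℝ} (hD0 : D 0 = 0) (hD : ∀ n, 0 ≤ D n) :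
    0 ≤ ∑ i : Fin K, a i * (D (i + 1) - D i) ∧
      (∑ i : Fin K, a i * (D (i + 1) - D i) = 0 →
        ∀ i : Fin K, (∀ j : Fin K, (i : ℕ) + 1 = j → a j < a i) → D (i + 1) = 0) := by
  -- Extending the weights by zero makes the last drop equal to the last weight, which is positive,
  -- so the last index is covered by the same argument.
  set e : ℕ → ℝ := fun n => if hn : n < K then a ⟨n, hn⟩ else 0 with he
  have hea : ∀ i : Fin K, e i = a i := fun i => by simp [he]
  have hparts : ∀ n, ∑ i ∈ Finset.range n, e i * (D (i + 1) - D i)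
      = e n * D n + ∑ i ∈ Finset.range n, (e i - e (i + 1)) * D (i + 1) := by
    intro n
    induction n with
    | zero => simp [hD0]
    | succ n ih =>
      rw [Finset.sum_range_succ, Finset.sum_range_succ, ih]
      ring
  have hsum : ∑ i : Fin K, a i * (D (i + 1) - D i)
      = ∑ i : Fin K, (e i - e (i + 1)) * D (i + 1) := by
    have h1 := hparts K
    have h2 : e K = 0 := by simp [he]
    rw [h2, zero_mul, zero_add, ← Fin.sum_univ_eq_sum_range (fun i => e i * (D (i + 1) - D i)),
      ← Fin.sum_univ_eq_sum_range (fun i => (e i - e (i + 1)) * D (i + 1))] at h1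
    simpa only [hea] using h1
  have hdrop : ∀ i : Fin K, 0 ≤ e i - e (i + 1) := by
    intro i
    rw [hea]
    by_cases hi : (i : ℕ) + 1 < K
    · simp only [he, hi, dif_pos, sub_nonneg]
      exact ha (by simp [Fin.le_def])
    · simp only [he, hi, dif_neg, not_false_eq_true, sub_zero]
      exact (hpos i).le
  have hterm : ∀ i ∈ Finset.univ, 0 ≤ (e (i : Fin K) - e (i + 1)) * D (i + 1) :=
    fun i _ => mul_nonneg (hdrop i) (hD _)
  rw [hsum]
  refine ⟨Finset.sum_nonneg hterm, fun h0 i hi => ?_⟩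
  have h1 := (Finset.sum_eq_zero_iff_of_nonneg hterm).1 h0 i (Finset.mem_univ i)
  refine (mul_eq_zero.1 h1).resolve_left (ne_of_gt ?_)
  rw [hea]
  by_cases hi' : (i : ℕ) + 1 < K
  · simp only [he, hi', dif_pos, sub_pos]
    exact hi ⟨i + 1, hi'⟩ rfl
  · simp only [he, hi', dif_neg, not_false_eq_true, sub_zero]
    exact hpos i

section MacOptimal

variable {ι : Type*} [Fintype ι] [DecidableEq ι] {K : ℕ}

/-- The log-determinant of the covariance of noise and the first `n` users. -/
noncomputable def macLogDet (A : Matrix ι ι ℂ) (h : Fin K → ι → ℂ) (π : Perm (Fin K))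
    (p : Fin K → ℝ) (n : ℕ) : ℝ :=
  Real.log (macCov A h π p (Finset.univ.filter fun k : Fin K => (k : ℕ) < n)).det.re

lemma filter_lt_eq_Iio (i : Fin K) :
    (Finset.univ.filter fun k : Fin K => (k : ℕ) < i) = Finset.Iio i := by
  ext k; simp

lemma filter_lt_succ_eq_Iic (i : Fin K) :
    (Finset.univ.filter fun k : Fin K => (k : ℕ) < i + 1) = Finset.Iic i := by
  ext k
  simp only [Finset.mem_filter, Finset.mem_univ, true_and, Finset.mem_Iic, Fin.le_def]
  omega

lemma macLogDet_zero (A : Matrix ι ι ℂ) (h : Fin K → ι → ℂ) (π : Perm (Fin K))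
    (p : Fin K → ℝ) : macLogDet A h π p 0 = Real.log A.det.re := by
  simp [macLogDet, macCov]

/-- The rates are increments of log-determinants, the form required by summation by parts; `log 2`
converts the base of the logarithm. -/
lemma log_two_mul_sum_macRate {A : Matrix ι ι ℂ} (hA : A.PosDef) (h : Fin K → ι → ℂ)
    (π : Perm (Fin K)) {p : Fin K → ℝ} (hp : ∀ i, 0 ≤ p i) (α : Fin K → ℝ) :
    Real.log 2 * ∑ u, α u * macRate A h π p u
      = ∑ i, α (π i) * (macLogDet A h π p (i + 1) - macLogDet A h π p i) := by
  rw [Finset.mul_sum, ← Equiv.sum_comp π]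
  refine Finset.sum_congr rfl fun i _ => ?_
  have h2 : Real.log 2 ≠ 0 := (Real.log_pos one_lt_two).ne'
  rw [macRate, Equiv.symm_apply_apply, macRateAt, macLogDet, macLogDet, filter_lt_eq_Iio,
    filter_lt_succ_eq_Iic, Real.logb,
    Real.log_div (det_re_pos (posDef_macCov hA h π hp _)).ne'
      (det_re_pos (posDef_macCov hA h π hp _)).ne']
  field_simp

lemma isCompact_macFeasible {nv : ℝ} (hnv : 0 < nv) (P : ℝ) :
    IsCompact (macFeasible K nv P) := by
  refine (isCompact_Icc (a := (0 : Fin K → ℝ)) (b := fun _ => P / nv)).of_isClosed_subset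
    ?_ ?_
  · rw [macFeasible, Set.ofPred_and, Set.ofPred_forall]
    refine (isClosed_iInter fun i => isClosed_le continuous_const (continuous_apply i)).inter
      (isClosed_le ?_ continuous_const)
    fun_prop
  · rintro p ⟨hp, hs⟩
    refine ⟨fun i => hp i, fun i => ?_⟩
    rw [le_div_iff₀ hnv, mul_comm]
    refine (mul_le_mul_of_nonneg_left ?_ hnv.le).trans hs
    exact Finset.single_le_sum (fun k _ => hp k) (Finset.mem_univ i)

theorem exists_isMacOptimal (α : Fin K → ℝ) {nv : ℝ} (hnv : 0 < nv) {A : Matrix ι ι ℂ}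
    (hA : A.PosDef) (h : Fin K → ι → ℂ) {P : ℝ} (hP : 0 ≤ P) (π : Perm (Fin K)) :
    ∃ p, IsMacOptimal α nv A h P π p := by
  have hcont : ContinuousOn (fun p => ∑ j, α j * macRate A h π p j) (macFeasible K nv P) := by
    have hdet : ∀ s : Finset (Fin K), Continuous fun p : Fin K → ℝ =>
        (macCov A h π p s).det.re := by
      intro s
      refine Complex.continuous_re.comp (Continuous.matrix_det ?_)
      unfold macCov
      fun_prop
    refine continuousOn_finsetSum _ fun j _ => continuousOn_const.mul ?_
    unfold macRate macRateAt Real.logb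
    refine ContinuousOn.div_const (ContinuousOn.log ?_ ?_) _
    · exact (hdet _).continuousOn.div (hdet _).continuousOn
        fun p hp => (det_re_pos (posDef_macCov hA h π hp.1 _)).ne'
    · exact fun p hp => (div_pos (det_re_pos (posDef_macCov hA h π hp.1 _))
        (det_re_pos (posDef_macCov hA h π hp.1 _))).ne'
  exact (isCompact_macFeasible hnv P).exists_isMaxOn ⟨0, fun _ => le_rfl, by simpa using hP⟩ hcont

lemma macCov_update_add {ι : Type*} {K : ℕ} (A : Matrix ι ι ℂ) (h : Fin K → ι → ℂ)
    (π : Perm (Fin K)) (p : Fin K → ℝ) (ε : ℝ) (i : Fin K) (s : Finset (Fin K)) :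
    macCov A h π (Function.update p (π i) (p (π i) + ε)) s
      = if i ∈ s then macCov A h π p s + (ε : ℂ) • vecMulVec (h (π i)) (star (h (π i)))
        else macCov A h π p s := by
  have hk : ∀ k, k ≠ i → Function.update p (π i) (p (π i) + ε) (π k) = p (π k) :=
    fun k hk => Function.update_of_ne (π.injective.ne hk) _ _
  split_ifs with hi
  · rw [macCov, macCov, ← Finset.add_sum_erase _ _ hi, ← Finset.add_sum_erase (a := i) _ _ hi,
      Function.update_self]
    rw [Finset.sum_congr rfl fun k hk' => by rw [hk k (Finset.ne_of_mem_erase hk')]]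
    push_cast
    rw [add_smul]
    abel
  · rw [macCov, macCov]
    congr 1
    refine Finset.sum_congr rfl fun k hks => ?_
    rw [hk k]
    rintro rfl
    exact hi hks

section Optimal

variable {α : Fin K → ℝ} {nv : ℝ} {A : Matrix ι ι ℂ} {h : Fin K → ι → ℂ} {P : ℝ}
  {π : Perm (Fin K)} {p p' : Fin K → ℝ}

/-- An optimal solution spends all the power. -/
theorem IsMacOptimal.power_eq (hα : ∀ i, 0 < α i) (hnv : 0 < nv) (hA : A.PosDef)
    (hh : ∃ i, h i ≠ 0) (hπ : Antitone (α ∘ π)) (hp : IsMacOptimal α nv A h P π p) :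
    nv * ∑ i, p i = P := by
  by_contra hne
  have hlt : nv * ∑ i, p i < P := lt_of_le_of_ne hp.1.2 hne
  obtain ⟨u, hu⟩ := hh
  obtain ⟨i, rfl⟩ := π.surjective u
  set ε := (P - nv * ∑ i, p i) / nv with hε
  have hεpos : 0 < ε := div_pos (sub_pos.2 hlt) hnv
  -- All unused power goes to one user with non-zero channel.
  set q := Function.update p (π i) (p (π i) + ε) with hq
  have hqfeas : q ∈ macFeasible K nv P := by
    refine ⟨fun k => ?_, ?_⟩
    · rcases eq_or_ne k (π i) with rfl | hk
      · rw [hq, Function.update_self]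
        exact add_nonneg (hp.1.1 _) hεpos.le
      · rw [hq, Function.update_of_ne hk]
        exact hp.1.1 k
    · have : ∑ k, q k = ∑ k, p k + ε := by
        rw [← Finset.add_sum_erase _ _ (Finset.mem_univ (π i)),
          ← Finset.add_sum_erase (a := π i) _ p (Finset.mem_univ (π i)), hq,
          Function.update_self,
          Finset.sum_congr rfl fun k hk => Function.update_of_ne (Finset.ne_of_mem_erase hk) _ _]
        ring
      rw [this, hε, mul_add, mul_div_cancel₀ _ hnv.ne']
      linarith
  have hle := isMaxOn_iff.1 hp.2 q hqfeas
  have hinc : ∀ s : Finset (Fin K), Real.log (macCov A h π p s).det.re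
      ≤ Real.log (macCov A h π q s).det.re ∧
      (i ∈ s → Real.log (macCov A h π p s).det.re < Real.log (macCov A h π q s).det.re) := by
    intro s
    have hM := posDef_macCov hA h π hp.1.1 s
    have hd := det_re_pos hM
    rw [hq, macCov_update_add]
    split_ifs with hi
    · rw [det_re_add_vecMulVec hM]
      have hκ := mul_pos hεpos (rxPower_pos hu hM.inv)
      have : Real.log (macCov A h π p s).det.re < Real.log ((macCov A h π p s).det.re *
          (1 + ε * rxPower (h (π i)) (macCov A h π p s)⁻¹)) :=
        Real.log_lt_log hd (by nlinarith)
      exact ⟨this.le, fun _ => this⟩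
    · exact ⟨le_rfl, fun hh => absurd hh hi⟩
  obtain ⟨h1, h2⟩ := sum_mul_sub_nonneg_of_antitone hπ (fun k => hα (π k))
    (D := fun n => macLogDet A h π q n - macLogDet A h π p n)
    (by simp [macLogDet_zero]) (fun n => sub_nonneg.2 (hinc _).1)
  have h3 : ∑ k : Fin K, (α ∘ π) k * ((macLogDet A h π q (k + 1) - macLogDet A h π p (k + 1))
      - (macLogDet A h π q k - macLogDet A h π p k))
      = Real.log 2 * (∑ u, α u * macRate A h π q u - ∑ u, α u * macRate A h π p u) := by
    rw [mul_sub, log_two_mul_sum_macRate hA h π hqfeas.1, log_two_mul_sum_macRate hA h π hp.1.1,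
      ← Finset.sum_sub_distrib]
    refine Finset.sum_congr rfl fun k _ => ?_
    simp only [Function.comp_apply]
    ring
  have h4 : ∑ k : Fin K, (α ∘ π) k * ((macLogDet A h π q (k + 1) - macLogDet A h π p (k + 1))
      - (macLogDet A h π q k - macLogDet A h π p k)) = 0 := by
    refine le_antisymm ?_ h1
    rw [h3]
    exact mul_nonpos_of_nonneg_of_nonpos (Real.log_nonneg one_le_two) (sub_nonpos.2 hle)
  have hK := i.pos
  -- At the last position the drop condition is vacuous, and the covariance there contains every
  -- user, so its log-determinant must have increased strictly.
  have h5 := h2 h4 ⟨K - 1, by omega⟩ fun j hj => by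
    have := j.isLt
    simp only at hj
    omega
  have h6 := (hinc (Finset.univ.filter fun k : Fin K => (k : ℕ) < (K - 1) + 1)).2
    (by simp only [Finset.mem_filter, Finset.mem_univ, true_and]; omega)
  exact (sub_pos.2 h6).ne' h5

/-- Users without a channel get no power in an optimal solution. -/
lemma IsMacOptimal.eq_zero_of_channel_eq_zero (hα : ∀ i, 0 < α i) (hnv : 0 < nv)
    (hA : A.PosDef) (hh : ∃ i, h i ≠ 0) (hπ : Antitone (α ∘ π))
    (hp : IsMacOptimal α nv A h P π p) {u : Fin K} (hu : h u = 0) : p u = 0 := by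
  -- Switching user `u` off changes no rate, so the new powers are optimal too; both then spend the
  -- full budget.
  set q := Function.update p u 0 with hq
  have hcov : ∀ s, macCov A h π q s = macCov A h π p s := by
    intro s
    rw [macCov, macCov]
    congr 1
    refine Finset.sum_congr rfl fun k _ => ?_
    rcases eq_or_ne (π k) u with hk | hk
    · simp [hk, hu]
    · rw [hq, Function.update_of_ne hk]
  have hsum : ∑ k, p k = ∑ k, q k + p u := by
    rw [← Finset.add_sum_erase _ p (Finset.mem_univ u),
      ← Finset.add_sum_erase (a := u) _ q (Finset.mem_univ u), hq, Function.update_self,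
      Finset.sum_congr rfl fun k hk => Function.update_of_ne (Finset.ne_of_mem_erase hk) _ _]
    ring
  have hq0 : ∀ k, 0 ≤ q k := by
    intro k
    rcases eq_or_ne k u with rfl | hk
    · simp [hq]
    · rw [hq, Function.update_of_ne hk]
      exact hp.1.1 k
  have hrate : macRate A h π q = macRate A h π p := by
    funext j
    simp only [macRate, macRateAt, hcov]
  have hqopt : IsMacOptimal α nv A h P π q := by
    refine ⟨⟨hq0, ?_⟩, isMaxOn_iff.2 fun x hx => ?_⟩
    · have h1 := hp.1.2
      have h2 := mul_nonneg hnv.le (hp.1.1 u)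
      rw [hsum, mul_add] at h1
      linarith
    · rw [hrate]
      exact isMaxOn_iff.1 hp.2 x hx
  have h1 := hp.power_eq hα hnv hA hh hπ
  have h2 := hqopt.power_eq hα hnv hA hh hπ
  rw [hsum, mul_add, h2] at h1
  have : nv * p u = 0 := by linarith
  exact (mul_eq_zero.1 this).resolve_left hnv.ne'

/-- Optimal solutions are unique if, for users of equal weight, the powers are determined by the
sum of the received covariances. -/
theorem IsMacOptimal.unique (hα : ∀ i, 0 < α i) (hnv : 0 < nv)
    (hA : A.PosDef) (hh : ∃ i, h i ≠ 0) (hπ : Antitone (α ∘ π))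
    (hind : ∀ (c : ℝ) (x : Fin K → ℝ),
      ∑ u ∈ Finset.univ.filter (fun u => α u = c), (x u : ℂ) • vecMulVec (h u) (star (h u)) = 0 →
      ∀ u, α u = c → h u ≠ 0 → x u = 0)
    (hp : IsMacOptimal α nv A h P π p) (hp' : IsMacOptimal α nv A h P π p') : p = p' := by
  set m : Fin K → ℝ := fun k => (p k + p' k) / 2 with hm
  have hmfeas : m ∈ macFeasible K nv P := by
    refine ⟨fun k => div_nonneg (add_nonneg (hp.1.1 k) (hp'.1.1 k)) two_pos.le, ?_⟩
    have h1 := hp.1.2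
    have h2 := hp'.1.2
    rw [hm, ← Finset.sum_div, Finset.sum_add_distrib]
    linarith
  have hmid : ∀ s, macCov A h π p s + macCov A h π p' s
      = macCov A h π m s + macCov A h π m s := by
    intro s
    simp only [macCov]
    rw [add_add_add_comm A _ A, add_add_add_comm A _ A, ← Finset.sum_add_distrib,
      ← Finset.sum_add_distrib]
    congr 1
    refine Finset.sum_congr rfl fun k _ => ?_
    rw [← add_smul, ← add_smul, hm]
    push_cast
    congr 1
    ring
  have hconc : ∀ s, _ := fun s => log_det_midpoint (posDef_macCov hA h π hp.1.1 s)
    (posDef_macCov hA h π hp'.1.1 s) (posDef_macCov hA h π hmfeas.1 s) (hmid s)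
  -- `D n` is the concavity gap at the midpoint of the two solutions. It starts at zero because the
  -- covariance of no users is `A`.
  obtain ⟨h1, h2⟩ := sum_mul_sub_nonneg_of_antitone hπ (fun k => hα (π k))
    (D := fun n => 2 * macLogDet A h π m n - (macLogDet A h π p n + macLogDet A h π p' n))
    (by simp only [macLogDet_zero]; ring) (fun n => sub_nonneg.2 (hconc _).1)
  have h3 : ∑ k : Fin K, (α ∘ π) k *
      ((2 * macLogDet A h π m (k + 1)
        - (macLogDet A h π p (k + 1) + macLogDet A h π p' (k + 1)))
      - (2 * macLogDet A h π m k - (macLogDet A h π p k + macLogDet A h π p' k)))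
      = Real.log 2 * (2 * ∑ u, α u * macRate A h π m u - ∑ u, α u * macRate A h π p u
        - ∑ u, α u * macRate A h π p' u) := by
    rw [mul_sub, mul_sub, mul_left_comm, log_two_mul_sum_macRate hA h π hmfeas.1,
      log_two_mul_sum_macRate hA h π hp.1.1, log_two_mul_sum_macRate hA h π hp'.1.1,
      Finset.mul_sum, ← Finset.sum_sub_distrib, ← Finset.sum_sub_distrib]
    refine Finset.sum_congr rfl fun k _ => ?_
    simp only [Function.comp_apply]
    ring
  have h4 := h2 (by
    refine le_antisymm ?_ h1
    rw [h3]
    have h5 := isMaxOn_iff.1 hp.2 m hmfeas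
    have h6 := isMaxOn_iff.1 hp'.2 m hmfeas
    exact mul_nonpos_of_nonneg_of_nonpos (Real.log_nonneg one_le_two) (by linarith))
  set G : Fin K → Matrix ι ι ℂ := fun k =>
    ((p (π k) - p' (π k) : ℝ) : ℂ) • vecMulVec (h (π k)) (star (h (π k))) with hG
  have hIic : ∀ i : Fin K, (∀ j : Fin K, (i : ℕ) + 1 = j → α (π j) < α (π i)) →
      ∑ k ∈ Finset.Iic i, G k = 0 := by
    intro i hi
    have h5 := (hconc _).2 (sub_eq_zero.1 (h4 i hi)).symm
    rw [filter_lt_succ_eq_Iic, macCov, macCov, add_right_inj, ← sub_eq_zero,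
      ← Finset.sum_sub_distrib] at h5
    rw [← h5]
    refine Finset.sum_congr rfl fun k _ => ?_
    rw [hG, ← sub_smul]
    push_cast
    rfl
  -- A set of positions whose weights strictly exceed all others is an initial segment ending at a
  -- drop. Subtracting two such sets below isolates the users with the weight of `u`.
  have hupper : ∀ s : Finset (Fin K), (∀ i ∈ s, ∀ k, k ∉ s → α (π k) < α (π i)) →
      ∑ k ∈ s, G k = 0 := by
    intro s hs
    rcases s.eq_empty_or_nonempty with rfl | hne
    · simp
    have hmax := s.max'_mem hne
    have hsI : s = Finset.Iic (s.max' hne) := by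
      ext k
      refine ⟨fun hk => Finset.mem_Iic.2 (s.le_max' k hk), fun hk => ?_⟩
      by_contra hks
      exact (hs _ hmax k hks).not_ge (hπ (Finset.mem_Iic.1 hk))
    rw [hsI]
    refine hIic _ fun j hj => hs _ hmax j fun hjs => ?_
    have := s.le_max' j hjs
    rw [Fin.le_def] at this
    omega
  funext u
  by_cases hu : h u = 0
  · rw [hp.eq_zero_of_channel_eq_zero hα hnv hA hh hπ hu,
      hp'.eq_zero_of_channel_eq_zero hα hnv hA hh hπ hu]
  refine sub_eq_zero.1 (hind (α u) (fun u => p u - p' u) ?_ u rfl hu)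
  have hge := hupper (Finset.univ.filter fun k => α u ≤ α (π k)) (by
    intro i hi k hk
    simp only [Finset.mem_filter, Finset.mem_univ, true_and, not_le] at hi hk
    linarith)
  have hgt := hupper (Finset.univ.filter fun k => α u < α (π k)) (by
    intro i hi k hk
    simp only [Finset.mem_filter, Finset.mem_univ, true_and, not_lt] at hi hk
    linarith)
  have hsplit : ∑ k ∈ Finset.univ.filter (fun k => α u ≤ α (π k)), G k
      = ∑ k ∈ Finset.univ.filter (fun k => α u < α (π k)), G k
        + ∑ k ∈ Finset.univ.filter (fun k => α (π k) = α u), G k := by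
    rw [← Finset.sum_union]
    · congr 1
      ext k
      simp only [Finset.mem_filter, Finset.mem_univ, true_and, Finset.mem_union]
      rw [le_iff_lt_or_eq, eq_comm (a := α u)]
    · rw [Finset.disjoint_filter]
      intro k _ hk hk'
      exact hk.ne' hk'
  rw [hge, hgt, zero_add] at hsplit
  rw [hsplit]
  refine (Finset.sum_equiv π (fun k => by simp) fun k _ => rfl).symm

end Optimal

end MacOptimal

end MISOBC

/-! ### Optimal points of the broadcast problem. -/

namespace MISOBC

open Matrix Equiv

section BcOptimal

variable {ι : Type*} [Fintype ι] {K : ℕ}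

lemma orderRegion_subset_bcRegion (nv : ℝ) (h : Fin K → ι → ℂ) (π : Perm (Fin K))
    (S : Fin K → Matrix ι ι ℂ) : orderRegion nv h π S ⊆ bcRegion nv h S :=
  Set.subset_iUnion (fun π => orderRegion nv h π S) π

lemma wsrFeasible_orderRegion_subset (nv : ℝ) (h : Fin K → ι → ℂ) (π : Perm (Fin K))
    (A : Matrix ι ι ℂ) (P : ℝ) :
    wsrFeasible (orderRegion nv h π) A P ⊆ wsrFeasible (bcRegion nv h) A P :=
  fun _ hx => ⟨orderRegion_subset_bcRegion nv h π _ hx.1, hx.2⟩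

lemma mem_wsrFeasible_bcRegion {nv : ℝ} {h : Fin K → ι → ℂ} {A : Matrix ι ι ℂ} {P : ℝ}
    {x : (Fin K → Matrix ι ι ℂ) × (Fin K → ℝ)} :
    x ∈ wsrFeasible (bcRegion nv h) A P ↔ ∃ π, x ∈ wsrFeasible (orderRegion nv h π) A P := by
  simp [wsrFeasible, bcRegion]

variable [DecidableEq ι] {α : Fin K → ℝ} {nv : ℝ} {A : Matrix ι ι ℂ} {h : Fin K → ι → ℂ}
  {P : ℝ}

/-- A feasible point of the broadcast problem is dominated by a feasible point of the dual
multiple access problem. -/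
lemma exists_macFeasible_of_mem_wsrFeasible (hnv : 0 < nv) (hA : A.PosDef) {τ : Perm (Fin K)}
    {S : Fin K → Matrix ι ι ℂ} {r : Fin K → ℝ}
    (hx : (S, r) ∈ wsrFeasible (orderRegion nv h τ) A P) :
    ∃ p ∈ macFeasible K nv P, (∀ u, r u ≤ macRate A h τ p u) ∧
      (nv * ∑ i, p i = P → ∀ i,
        S (τ i) = ((p (τ i) * bcNoise nv h S τ i / macGain A h τ p i : ℝ) : ℂ) •
          vecMulVec ((macCov A h τ p (Finset.Iio i))⁻¹ *ᵥ h (τ i))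
            (star ((macCov A h τ p (Finset.Iio i))⁻¹ *ᵥ h (τ i)))) := by
  obtain ⟨hr, htr, hS⟩ := hx
  obtain ⟨p, hp, hle, hrate, hbeam⟩ := exists_mac_of_bc hnv hA h hS τ
  refine ⟨p, ⟨hp, hle.trans htr⟩, fun u => ?_, fun heq => hbeam ?_⟩
  · rw [macRate, hrate]
    simpa using hr.2 (τ.symm u)
  · exact le_antisymm hle (heq ▸ htr)

/-- Weak duality: pass to the dual channel in the order of the point, then sort that order. -/
lemma sum_le_of_mem_wsrFeasible (hα : ∀ i, 0 < α i) (hnv : 0 < nv) (hA : A.PosDef)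
    {π : Perm (Fin K)} (hπ : Antitone (α ∘ π)) {p : Fin K → ℝ}
    (hp : IsMacOptimal α nv A h P π p) {x : (Fin K → Matrix ι ι ℂ) × (Fin K → ℝ)}
    (hx : x ∈ wsrFeasible (bcRegion nv h) A P) :
    ∑ u, α u * x.2 u ≤ ∑ u, α u * macRate A h π p u := by
  obtain ⟨τ, hτ⟩ := mem_wsrFeasible_bcRegion.1 hx
  obtain ⟨p', hp', hr, -⟩ := exists_macFeasible_of_mem_wsrFeasible hnv hA hτ
  calc ∑ u, α u * x.2 u ≤ ∑ u, α u * macRate A h τ p' u :=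
        Finset.sum_le_sum fun u _ => mul_le_mul_of_nonneg_left (hr u) (hα u).le
    _ ≤ ∑ u, α u * macRate A h π p' u := sum_macRate_le_of_antitone hA h hp'.1 hπ τ
    _ ≤ _ := isMaxOn_iff.1 hp.2 p' hp'

/-- The broadcast problem is solved through its dual multiple access channel. -/
theorem IsMacOptimal.exists_downlink (hα : ∀ i, 0 < α i) (hnv : 0 < nv) (hA : A.PosDef)
    {π : Perm (Fin K)} (hπ : Antitone (α ∘ π)) {p : Fin K → ℝ}
    (hp : IsMacOptimal α nv A h P π p) :
    ∃ q : Fin K → ℝ, (∀ i, 0 ≤ q i) ∧ IsDownlinkPower nv A h π p q ∧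
      macRate A h π p ∈ orderRegion nv h π (beamCov A h π p q) ∧
      (beamCov A h π p q, macRate A h π p) ∈ wsrFeasible (orderRegion nv h π) A P ∧
      IsWsrOptimal α (bcRegion nv h) A P (beamCov A h π p q, macRate A h π p) := by
  obtain ⟨q, hq, hdown, hrate, htr⟩ := exists_isDownlinkPower hnv hA h π hp.1.1
  have hmem : macRate A h π p ∈ orderRegion nv h π (beamCov A h π p q) := by
    refine ⟨fun u => macRateAt_nonneg hA h π hp.1.1 _, fun i => ?_⟩
    rw [hrate, macRate, Equiv.symm_apply_apply]
  have hfeas : (beamCov A h π p q, macRate A h π p) ∈ wsrFeasible (orderRegion nv h π) A P :=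
    ⟨hmem, htr.trans hp.1.2, fun i => posSemidef_beamCov A h π p q i⟩
  exact ⟨q, hq, hdown, hmem, hfeas, wsrFeasible_orderRegion_subset _ _ _ _ _ hfeas,
    isMaxOn_iff.2 fun x hx => sum_le_of_mem_wsrFeasible hα hnv hA hπ hp hx⟩

/-- The structure of the points that attain the optimal value. -/
theorem exists_isMacOptimal_of_le (hα : ∀ i, 0 < α i) (hnv : 0 < nv) (hA : A.PosDef)
    (hh : ∃ i, h i ≠ 0) {π τ : Perm (Fin K)} (hπ : Antitone (α ∘ π)) {p₀ : Fin K → ℝ}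
    (hp₀ : IsMacOptimal α nv A h P π p₀)
    {S : Fin K → Matrix ι ι ℂ} {r : Fin K → ℝ}
    (hx : (S, r) ∈ wsrFeasible (orderRegion nv h τ) A P)
    (hval : ∑ u, α u * macRate A h π p₀ u ≤ ∑ u, α u * r u) :
    ∃ p, IsMacOptimal α nv A h P π p ∧ r = macRate A h τ p ∧
      ∑ u, α u * macRate A h τ p u = ∑ u, α u * macRate A h π p u ∧
      ∀ i, S (τ i) = ((p (τ i) * bcNoise nv h S τ i / macGain A h τ p i : ℝ) : ℂ) •
          vecMulVec ((macCov A h τ p (Finset.Iio i))⁻¹ *ᵥ h (τ i))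
            (star ((macCov A h τ p (Finset.Iio i))⁻¹ *ᵥ h (τ i))) := by
  obtain ⟨p, hp, hr, hbeam⟩ := exists_macFeasible_of_mem_wsrFeasible hnv hA hx
  -- The chain from `r` to the dual rates in order `τ`, then in order `π`, then to the optimum
  -- closes by `hval`, so all its inequalities are equalities.
  have hterm : ∀ u ∈ Finset.univ, α u * r u ≤ α u * macRate A h τ p u :=
    fun u _ => mul_le_mul_of_nonneg_left (hr u) (hα u).le
  have h1 := Finset.sum_le_sum hterm
  have h2 := sum_macRate_le_of_antitone hA h hp.1 hπ τ
  have h3 := isMaxOn_iff.1 hp₀.2 p hp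
  have hopt : IsMacOptimal α nv A h P π p :=
    ⟨hp, isMaxOn_iff.2 fun p' hp' => (isMaxOn_iff.1 hp₀.2 p' hp').trans (by linarith)⟩
  refine ⟨p, hopt, funext fun u => ?_, by linarith, hbeam (hopt.power_eq hα hnv hA hh hπ)⟩
  have h4 := (Finset.sum_eq_sum_iff_of_le hterm).1 (by linarith) u (Finset.mem_univ u)
  exact mul_left_cancel₀ (hα u).ne' h4

lemma exists_antitone_comp_perm (α : Fin K → ℝ) : ∃ π : Perm (Fin K), Antitone (α ∘ π) := by
  have := Tuple.monotone_sort fun i => -α i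
  exact ⟨Tuple.sort fun i => -α i, fun i j hij => neg_le_neg_iff.1 (this hij)⟩

lemma IsWsrOptimal.le_of_bcRegion (hα : ∀ i, 0 < α i) (hnv : 0 < nv) (hA : A.PosDef)
    {π : Perm (Fin K)} (hπ : Antitone (α ∘ π)) {p : Fin K → ℝ}
    (hp : IsMacOptimal α nv A h P π p) {x : (Fin K → Matrix ι ι ℂ) × (Fin K → ℝ)}
    (hx : IsWsrOptimal α (bcRegion nv h) A P x) :
    ∑ u, α u * macRate A h π p u ≤ ∑ u, α u * x.2 u := by
  obtain ⟨q, -, -, -, -, hq⟩ := hp.exists_downlink hα hnv hA hπ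
  exact isMaxOn_iff.1 hx.2 _ hq.1

lemma IsWsrOptimal.le_of_orderRegion (hα : ∀ i, 0 < α i) (hnv : 0 < nv) (hA : A.PosDef)
    {π : Perm (Fin K)} (hπ : Antitone (α ∘ π)) {p : Fin K → ℝ}
    (hp : IsMacOptimal α nv A h P π p) {x : (Fin K → Matrix ι ι ℂ) × (Fin K → ℝ)}
    (hx : IsWsrOptimal α (orderRegion nv h π) A P x) :
    ∑ u, α u * macRate A h π p u ≤ ∑ u, α u * x.2 u := by
  obtain ⟨q, -, -, -, hq, -⟩ := hp.exists_downlink hα hnv hA hπ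
  exact isMaxOn_iff.1 hx.2 _ hq

theorem exists_isWsrOptimal (hα : ∀ i, 0 < α i) (hnv : 0 < nv) (hA : A.PosDef) (hP : 0 ≤ P)
    {π : Perm (Fin K)} (hπ : Antitone (α ∘ π)) :
    ∃ x, IsWsrOptimal α (orderRegion nv h π) A P x ∧ IsWsrOptimal α (bcRegion nv h) A P x := by
  obtain ⟨p, hp⟩ := exists_isMacOptimal α hnv hA h hP π
  obtain ⟨q, -, -, -, hq, hopt⟩ := hp.exists_downlink hα hnv hA hπ
  exact ⟨_, ⟨hq, isMaxOn_iff.2 fun x hx => isMaxOn_iff.1 hopt.2 x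
    (wsrFeasible_orderRegion_subset _ _ _ _ _ hx)⟩, hopt⟩

theorem rank_le_one_of_isWsrOptimal (hα : ∀ i, 0 < α i) (hnv : 0 < nv) (hA : A.PosDef)
    (hP : 0 ≤ P) (hh : ∃ i, h i ≠ 0) {S : Fin K → Matrix ι ι ℂ} {r : Fin K → ℝ}
    (hx : IsWsrOptimal α (bcRegion nv h) A P (S, r)) (i : Fin K) : (S i).rank ≤ 1 := by
  obtain ⟨π, hπ⟩ := exists_antitone_comp_perm α
  obtain ⟨p₀, hp₀⟩ := exists_isMacOptimal α hnv hA h hP π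
  obtain ⟨τ, hτ⟩ := mem_wsrFeasible_bcRegion.1 hx.1
  obtain ⟨p, -, -, -, hbeam⟩ := exists_isMacOptimal_of_le hα hnv hA hh hπ hp₀ hτ
    (hx.le_of_bcRegion hα hnv hA hπ hp₀)
  obtain ⟨k, rfl⟩ := τ.surjective i
  rw [hbeam, ← smul_vecMulVec]
  exact rank_vecMulVec_le _ _

/-- For pairwise different weights, an optimal point can be achieved by sorting the users. -/
theorem IsWsrOptimal.mem_orderRegion_of_injective (hα : ∀ i, 0 < α i) (hnv : 0 < nv)
    (hA : A.PosDef) (hP : 0 ≤ P) (hh : ∃ i, h i ≠ 0) (hinj : Function.Injective α)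
    {π : Perm (Fin K)} (hπ : Antitone (α ∘ π)) {S : Fin K → Matrix ι ι ℂ} {r : Fin K → ℝ}
    (hx : IsWsrOptimal α (bcRegion nv h) A P (S, r)) : r ∈ orderRegion nv h π S := by
  obtain ⟨p₀, hp₀⟩ := exists_isMacOptimal α hnv hA h hP π
  obtain ⟨τ₀, hτ₀⟩ := mem_wsrFeasible_bcRegion.1 hx.1
  refine perm_sort_induction π (Q := fun τ => r ∈ orderRegion nv h τ S) ?_ hτ₀.1
  intro τ i j hij hlt hτ
  have hne : i ≠ j := by
    rintro rfl
    omega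
  obtain ⟨p, hp, -, hsum, hbeam⟩ := exists_isMacOptimal_of_le hα hnv hA hh hπ hp₀
    (show (S, r) ∈ wsrFeasible (orderRegion nv h τ) A P from ⟨hτ, hx.1.2⟩)
    (hx.le_of_bcRegion hα hnv hA hπ hp₀)
  have h1 := sum_macRate_swap_sub hij hA h τ hp.1.1 α
  obtain ⟨-, -, h2, h3⟩ := macRate_swap hij hA h τ hp.1.1
  have h4 := sum_macRate_le_of_antitone hA h hp.1.1 hπ (τ * swap i j)
  have h5 : α (τ i) < α (τ j) := by
    have := hπ hlt.le
    simp only [Function.comp_apply, Equiv.apply_symm_apply] at this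
    exact lt_of_le_of_ne this fun he => hne (τ.injective (hinj he))
  have h6 := mul_nonneg (sub_pos.2 h5).le (sub_nonneg.2 h2)
  -- By `hsum` the order `τ` already attains the sorted value, so the exchange, which cannot lower
  -- the sum, cannot raise it either.
  have h7 : (α (τ j) - α (τ i)) *
      (macRate A h (τ * swap i j) p (τ j) - macRate A h τ p (τ j)) = 0 := by linarith
  have h8 := sub_eq_zero.1 ((mul_eq_zero.1 h7).resolve_left (sub_pos.2 h5).ne')
  refine mem_orderRegion_swap hij hnv (S := S) hx.1.2.2 ?_ hτ
  -- Zero power makes the beam covariance zero, and orthogonality makes the beam of `τ i` invisible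
  -- to `τ j`; each case lets the exchange keep the rates.
  rcases h3 h8.symm with h9 | h9 | h9
  · right
    rw [hbeam i, h9]
    simp
  · left
    rw [hbeam j, h9]
    simp
  · right
    rw [hbeam i, rxPower_smul, rxPower_vecMulVec, h9]
    simp

/-- Two optimal points with sorted encoding order coincide. -/
theorem eq_of_mem_orderRegion (hα : ∀ i, 0 < α i) (hnv : 0 < nv) (hA : A.PosDef)
    (hh : ∃ i, h i ≠ 0) {π : Perm (Fin K)} (hπ : Antitone (α ∘ π))
    (hind : ∀ (c : ℝ) (x : Fin K → ℝ),
      ∑ u ∈ Finset.univ.filter (fun u => α u = c), (x u : ℂ) • vecMulVec (h u) (star (h u)) = 0 →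
      ∀ u, α u = c → h u ≠ 0 → x u = 0) {p₀ : Fin K → ℝ}
    (hp₀ : IsMacOptimal α nv A h P π p₀) {x y : (Fin K → Matrix ι ι ℂ) × (Fin K → ℝ)}
    (hx : x ∈ wsrFeasible (orderRegion nv h π) A P)
    (hy : y ∈ wsrFeasible (orderRegion nv h π) A P)
    (hxval : ∑ u, α u * macRate A h π p₀ u ≤ ∑ u, α u * x.2 u)
    (hyval : ∑ u, α u * macRate A h π p₀ u ≤ ∑ u, α u * y.2 u) : x = y := by
  obtain ⟨p, hp, hr, -, hbeam⟩ := exists_isMacOptimal_of_le hα hnv hA hh hπ hp₀ hx hxval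
  obtain ⟨p', hp', hr', -, hbeam'⟩ := exists_isMacOptimal_of_le hα hnv hA hh hπ hp₀ hy hyval
  obtain rfl := hp.unique hα hnv hA hh hπ hind hp'
  refine Prod.ext (funext fun u => ?_) (hr.trans hr'.symm)
  obtain ⟨i, rfl⟩ := π.surjective u
  -- The beams are fixed by `p` up to scale, and each scale depends only on the noise from later
  -- users: hence induction from the last position.
  induction i using WellFoundedGT.induction with
  | ind i ih =>
    have hnoise : bcNoise nv h x.1 π i = bcNoise nv h y.1 π i := by
      rw [bcNoise, bcNoise, Finset.sum_congr rfl fun k hk => ih k (Finset.mem_Ioi.1 hk)]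
    rw [hbeam, hbeam', hnoise]

theorem existsUnique_isWsrOptimal_of_injective (hα : ∀ i, 0 < α i) (hnv : 0 < nv)
    (hA : A.PosDef) (hP : 0 ≤ P) (hh : ∃ i, h i ≠ 0) (hinj : Function.Injective α) :
    ∃! x, IsWsrOptimal α (bcRegion nv h) A P x := by
  obtain ⟨π, hπ⟩ := exists_antitone_comp_perm α
  obtain ⟨p₀, hp₀⟩ := exists_isMacOptimal α hnv hA h hP π
  obtain ⟨x₀, -, hx₀⟩ := exists_isWsrOptimal (h := h) hα hnv hA hP hπ
  have hmem : ∀ x, IsWsrOptimal α (bcRegion nv h) A P x →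
      x ∈ wsrFeasible (orderRegion nv h π) A P := fun x hx =>
    ⟨IsWsrOptimal.mem_orderRegion_of_injective hα hnv hA hP hh hinj hπ hx, hx.1.2⟩
  refine ⟨x₀, hx₀, fun x hx => eq_of_mem_orderRegion hα hnv hA hh hπ ?_ hp₀ (hmem x hx)
    (hmem x₀ hx₀) (hx.le_of_bcRegion hα hnv hA hπ hp₀) (hx₀.le_of_bcRegion hα hnv hA hπ hp₀)⟩
  -- Distinct weights make every weight class a singleton, so independence only needs a non-zero
  -- channel.
  rintro c x hsum u rfl hu
  have : (Finset.univ.filter fun v => α v = α u) = {u} := by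
    ext v
    simp [hinj.eq_iff]
  rw [this, Finset.sum_singleton, smul_eq_zero] at hsum
  rcases hsum with h1 | h1
  · exact_mod_cast h1
  · simp [hu] at h1

theorem existsUnique_isWsrOptimal_orderRegion (hα : ∀ i, 0 < α i) (hnv : 0 < nv)
    (hA : A.PosDef) (hP : 0 ≤ P)
    (hind : ∀ c : ℝ, LinearIndependent ℝ
      (fun i : {i : Fin K // α i = c} => vecMulVec (h i) (star (h i))))
    {π : Perm (Fin K)} (hπ : Antitone (α ∘ π)) :
    ∃! x, IsWsrOptimal α (orderRegion nv h π) A P x := by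
  obtain ⟨p₀, hp₀⟩ := exists_isMacOptimal α hnv hA h hP π
  obtain ⟨x₀, hx₀, -⟩ := exists_isWsrOptimal (h := h) hα hnv hA hP hπ
  refine ⟨x₀, hx₀, fun x hx => ?_⟩
  -- Linear independence forces non-zero channels as soon as there is a user; without users there is
  -- only one point.
  rcases isEmpty_or_nonempty (Fin K) with hK | ⟨⟨u⟩⟩
  · exact Prod.ext (Subsingleton.elim _ _) (Subsingleton.elim _ _)
  have hh : ∃ i, h i ≠ 0 := ⟨u, fun h0 => (hind (α u)).ne_zero ⟨u, rfl⟩ (by simp [h0])⟩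
  refine eq_of_mem_orderRegion hα hnv hA hh hπ ?_ hp₀ hx.1 hx₀.1
    (hx.le_of_orderRegion hα hnv hA hπ hp₀) (hx₀.le_of_orderRegion hα hnv hA hπ hp₀)
  intro c y hsum v hv _
  refine Fintype.linearIndependent_iff.1 (hind c) (fun i => y i) ?_ ⟨v, hv⟩
  rw [← hsum, ← Finset.sum_subtype_eq_sum_filter, Finset.subtype_univ]
  refine Finset.sum_congr rfl fun i _ => ?_
  ext a b
  simp

end BcOptimal

/-! ### Reduction to the range of the constraint matrix -/

section Reduction

variable {ι μ : Type*} [Fintype ι] [Fintype μ]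

lemma rxPower_mulVec (U : Matrix ι μ ℂ) (g : μ → ℂ) (S : Matrix ι ι ℂ) :
    rxPower (U *ᵥ g) S = rxPower g (Uᴴ * S * U) := by
  rw [rxPower, rxPower, star_mulVec, ← dotProduct_mulVec, mulVec_mulVec, mulVec_mulVec,
    Matrix.mul_assoc]

lemma dpcRate_compress {K : ℕ} (nv : ℝ) (U : Matrix ι μ ℂ) (g : Fin K → μ → ℂ)
    (S : Fin K → Matrix ι ι ℂ) (π : Perm (Fin K)) :
    dpcRate nv (fun i => U *ᵥ g i) S π = dpcRate nv g (fun i => Uᴴ * S i * U) π := by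
  funext i
  rw [dpcRate, dpcRate, rxPower_mulVec, rxPower_mulVec]
  simp only [Matrix.mul_sum, Matrix.sum_mul]

/-- When the channels and the constraint matrix factor through `U`, powers and traces see `S` only
through `Uᴴ S U`. -/
lemma mem_wsrFeasible_compress {K : ℕ} {nv : ℝ} {U : Matrix ι μ ℂ} {A' : Matrix μ μ ℂ}
    {g : Fin K → μ → ℂ} {P : ℝ} {S : Fin K → Matrix ι ι ℂ} {r : Fin K → ℝ}
    (hS : ∀ i, (S i).PosSemidef) :
    (S, r) ∈ wsrFeasible (bcRegion nv fun i => U *ᵥ g i) (U * A' * Uᴴ) P ↔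
      (fun i => Uᴴ * S i * U, r) ∈ wsrFeasible (bcRegion nv g) A' P := by
  have htr : ∀ i, (U * A' * Uᴴ * S i).trace = (A' * (Uᴴ * S i * U)).trace := by
    intro i
    rw [Matrix.mul_assoc, Matrix.mul_assoc, trace_mul_comm]
    simp only [Matrix.mul_assoc]
  have hps : ∀ i, (Uᴴ * S i * U).PosSemidef := fun i => (hS i).conjTranspose_mul_mul_same U
  simp only [wsrFeasible, bcRegion, orderRegion, Set.mem_ofPred_eq, Set.mem_iUnion,
    dpcRate_compress, htr, hS, hps, implies_true, and_true]

/-- The optimal points of the full problem are those whose compressions solve the reduced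
problem. -/
theorem isWsrOptimal_iff_compress [DecidableEq μ] {K : ℕ} {α : Fin K → ℝ} {nv : ℝ} {U : Matrix ι μ ℂ}
    (hUU : Uᴴ * U = 1) {A' : Matrix μ μ ℂ} {g : Fin K → μ → ℂ} {P : ℝ}
    {S : Fin K → Matrix ι ι ℂ} {r : Fin K → ℝ} (hS : ∀ i, (S i).PosSemidef) :
    IsWsrOptimal α (bcRegion nv fun i => U *ᵥ g i) (U * A' * Uᴴ) P (S, r) ↔
      IsWsrOptimal α (bcRegion nv g) A' P (fun i => Uᴴ * S i * U, r) := by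
  rw [IsWsrOptimal, IsWsrOptimal, mem_wsrFeasible_compress hS]
  refine and_congr_right fun _ => ?_
  rw [isMaxOn_iff, isMaxOn_iff]
  constructor
  · rintro hmax ⟨B, r'⟩ hB
    -- A competitor `B` of the reduced problem is lifted to `U B Uᴴ`, whose compression is `B`
    -- again.
    have hps : ∀ i, (U * B i * Uᴴ).PosSemidef := fun i => (hB.2.2 i).mul_mul_conjTranspose_same U
    refine hmax (fun i => U * B i * Uᴴ, r') ((mem_wsrFeasible_compress hps).2 ?_)
    have : ∀ i, Uᴴ * (U * B i * Uᴴ) * U = B i := by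
      intro i
      rw [show Uᴴ * (U * B i * Uᴴ) * U = (Uᴴ * U) * B i * (Uᴴ * U) by
        simp only [Matrix.mul_assoc], hUU]
      simp
    simpa only [this] using hB
  · rintro hmax ⟨S', r'⟩ hS'
    exact hmax (fun i => Uᴴ * S' i * U, r') ((mem_wsrFeasible_compress hS'.2.2).1 hS')

end Reduction

/-! ### Splitting the space along the singular value decomposition. -/

section SplitSVD

variable {ι μ ν : Type*} [Fintype ι] [Fintype μ] [Fintype ν] [DecidableEq ι] [DecidableEq μ]
  [DecidableEq ν] {A : Matrix ι ι ℂ} {U₁ : Matrix ι μ ℂ} {U₂ : Matrix ι ν ℂ}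

lemma IsSplitSVD.mul_add_mul (hU : IsSplitSVD A U₁ U₂) : U₁ * U₁ᴴ + U₂ * U₂ᴴ = 1 := by
  rw [← hU.1, conjTranspose_fromCols_eq_fromRows_conjTranspose, fromCols_mul_fromRows]

lemma IsSplitSVD.orthonormal (hU : IsSplitSVD A U₁ U₂) :
    U₁ᴴ * U₁ = 1 ∧ U₁ᴴ * U₂ = 0 ∧ U₂ᴴ * U₁ = 0 ∧ U₂ᴴ * U₂ = 1 := by
  have := hU.2.1
  rw [conjTranspose_fromCols_eq_fromRows_conjTranspose, fromRows_mul_fromCols, ← fromBlocks_one,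
    fromBlocks_inj] at this
  exact this

lemma IsSplitSVD.exists_eq (hU : IsSplitSVD A U₁ U₂) :
    ∃ d : μ → ℝ, (∀ i, 0 < d i) ∧ A = U₁ * diagonal (fun i => (d i : ℂ)) * U₁ᴴ := by
  obtain ⟨d, hd, hA⟩ := hU.2.2
  refine ⟨d, hd, ?_⟩
  rw [hA, conjTranspose_fromCols_eq_fromRows_conjTranspose, ← fromBlocks_diagonal,
    fromCols_mul_fromBlocks, fromCols_mul_fromRows]
  simp

lemma IsSplitSVD.posDef (hU : IsSplitSVD A U₁ U₂) : (U₁ᴴ * A * U₁).PosDef := by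
  obtain ⟨d, hd, hA⟩ := hU.exists_eq
  have : U₁ᴴ * A * U₁ = diagonal fun i => (d i : ℂ) := by
    rw [hA, show U₁ᴴ * (U₁ * diagonal (fun i => (d i : ℂ)) * U₁ᴴ) * U₁
      = (U₁ᴴ * U₁) * diagonal (fun i => (d i : ℂ)) * (U₁ᴴ * U₁) by simp only [Matrix.mul_assoc],
      hU.orthonormal.1]
    simp
  rw [this]
  exact PosDef.diagonal fun i => by exact_mod_cast hd i

lemma IsSplitSVD.eq_mul_mul (hU : IsSplitSVD A U₁ U₂) : A = U₁ * (U₁ᴴ * A * U₁) * U₁ᴴ := by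
  obtain ⟨d, hd, hA⟩ := hU.exists_eq
  conv_rhs => rw [hA]
  rw [show U₁ * (U₁ᴴ * (U₁ * diagonal (fun i => (d i : ℂ)) * U₁ᴴ) * U₁) * U₁ᴴ
      = U₁ * ((U₁ᴴ * U₁) * diagonal (fun i => (d i : ℂ)) * (U₁ᴴ * U₁)) * U₁ᴴ by
      simp only [Matrix.mul_assoc], hU.orthonormal.1]
  simpa using hA

/-- The component `x` of `h i` along `U₂` lies in the null space of `A`, hence in that of `∑ h hᴴ`.
The quadratic form at `x` is a sum of squares, so `x` is orthogonal to `h i`, and therefore to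
itself. -/
lemma IsSplitSVD.channel_eq {K : ℕ} (hU : IsSplitSVD A U₁ U₂) {h : Fin K → ι → ℂ}
    (hnull : ∀ x : ι → ℂ, A *ᵥ x = 0 → (∑ i, vecMulVec (h i) (star (h i))) *ᵥ x = 0)
    (i : Fin K) : U₁ *ᵥ (U₁ᴴ *ᵥ h i) = h i := by
  set x := U₂ *ᵥ (U₂ᴴ *ᵥ h i) with hx
  have hdec : U₁ *ᵥ (U₁ᴴ *ᵥ h i) + x = h i := by
    rw [hx, mulVec_mulVec, mulVec_mulVec, ← add_mulVec, hU.mul_add_mul, one_mulVec]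
  have hAx : A *ᵥ x = 0 := by
    rw [hU.eq_mul_mul, hx, mulVec_mulVec, Matrix.mul_assoc, hU.orthonormal.2.1]
    simp
  have h1 : ∑ k, ‖star x ⬝ᵥ h k‖ ^ 2 = 0 := by
    have h2 : rxPower x (∑ k, vecMulVec (h k) (star (h k))) = 0 := by
      rw [rxPower, hnull x hAx]
      simp
    rw [rxPower_sum] at h2
    simpa only [rxPower_vecMulVec] using h2
  have h3 := (Finset.sum_eq_zero_iff_of_nonneg fun k _ => sq_nonneg _).1 h1 i (Finset.mem_univ i)
  rw [sq_eq_zero_iff, norm_eq_zero, ← hdec, dotProduct_add] at h3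
  have h4 : star x ⬝ᵥ U₁ *ᵥ (U₁ᴴ *ᵥ h i) = 0 := by
    rw [dotProduct_mulVec, hx, star_mulVec, vecMul_vecMul, hU.orthonormal.2.2.1]
    simp
  rw [h4, zero_add, dotProduct_star_self_eq_zero] at h3
  rw [h3, add_zero] at hdec
  exact hdec

lemma IsSplitSVD.block_decomposition (hU : IsSplitSVD A U₁ U₂) {S : Matrix ι ι ℂ}
    (hS : S.IsHermitian) :
    S = U₁ * (U₁ᴴ * S * U₁) * U₁ᴴ + U₁ * (U₁ᴴ * S * U₂) * U₂ᴴ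
      + U₂ * (U₁ᴴ * S * U₂)ᴴ * U₁ᴴ + U₂ * (U₂ᴴ * S * U₂) * U₂ᴴ := by
  have h1 : (U₁ * U₁ᴴ + U₂ * U₂ᴴ) * S * (U₁ * U₁ᴴ + U₂ * U₂ᴴ) = S := by
    rw [hU.mul_add_mul, Matrix.one_mul, Matrix.mul_one]
  conv_lhs => rw [← h1]
  simp only [conjTranspose_mul, conjTranspose_conjTranspose, hS.eq, Matrix.add_mul,
    Matrix.mul_add, Matrix.mul_assoc]
  abel

/-- Orthonormality removes every block but `B`, which is why the other blocks are constrained only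
by positive semidefiniteness. -/
lemma IsSplitSVD.compress_block (hU : IsSplitSVD A U₁ U₂) (B : Matrix μ μ ℂ)
    (C : Matrix μ ν ℂ) (C' : Matrix ν μ ℂ) (D : Matrix ν ν ℂ) :
    U₁ᴴ * (U₁ * B * U₁ᴴ + U₁ * C * U₂ᴴ + U₂ * C' * U₁ᴴ + U₂ * D * U₂ᴴ) * U₁ = B := by
  obtain ⟨h11, h12, h21, h22⟩ := hU.orthonormal
  simp only [Matrix.mul_add, Matrix.add_mul, Matrix.mul_assoc, h11, h21]
  simp only [← Matrix.mul_assoc, h11, h12]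
  simp

end SplitSVD

end MISOBC

theorem lemma3p3 {N K m : ℕ} (σ : ℝ) (hσ : 0 < σ)
    (α : Fin K → ℝ) (hα : ∀ i, 0 < α i)
    (h : Fin K → Fin N → ℂ)
    (A : Matrix (Fin N) (Fin N) ℂ) (hA : A.PosSemidef)
    (hnull : ∀ x : Fin N → ℂ, A.mulVec x = 0 →
      (∑ i, Matrix.vecMulVec (h i) (star (h i))).mulVec x = 0)
    (P : ℝ) (hP : 0 ≤ P) (hm : A.rank = m)
    (U₁ : Matrix (Fin N) (Fin m) ℂ) (U₂ : Matrix (Fin N) (Fin (N - m)) ℂ)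
    (hU : MISOBC.IsSplitSVD A U₁ U₂)
    (h' : Fin K → Fin m → ℂ) (hh' : ∀ i, h' i = U₁.conjTranspose.mulVec (h i))
    (A' : Matrix (Fin m) (Fin m) ℂ) (hA' : A' = U₁.conjTranspose * A * U₁) :
    -- the reduced matrix has full rank
    A'.PosDef ∧
    -- the reduced problem has a solution
    (∃ x, MISOBC.IsWsrOptimal α (MISOBC.bcRegion (σ ^ 2) h') A' P x) ∧
    -- the block form of the optimal covariances, with all admissible off-diagonal blocks
    (∀ (S : Fin K → Matrix (Fin N) (Fin N) ℂ) (r : Fin K → ℝ),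
      MISOBC.IsWsrOptimal α (MISOBC.bcRegion (σ ^ 2) h) A P (S, r) ↔
        ∃ (B : Fin K → Matrix (Fin m) (Fin m) ℂ)
          (C : Fin K → Matrix (Fin m) (Fin (N - m)) ℂ)
          (D : Fin K → Matrix (Fin (N - m)) (Fin (N - m)) ℂ),
          MISOBC.IsWsrOptimal α (MISOBC.bcRegion (σ ^ 2) h') A' P (B, r) ∧
          ∀ i, S i = U₁ * B i * U₁.conjTranspose + U₁ * C i * U₂.conjTranspose
              + U₂ * (C i).conjTranspose * U₁.conjTranspose + U₂ * D i * U₂.conjTranspose ∧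
            (S i).PosSemidef) ∧
    -- uniqueness in the reduced problem for pairwise different weights
    ((∃ i, h i ≠ 0) → Function.Injective α →
      ∃! x, MISOBC.IsWsrOptimal α (MISOBC.bcRegion (σ ^ 2) h') A' P x) ∧
    -- uniqueness for arbitrary weights and an encoding order that sorts them
    ((∀ c : ℝ, LinearIndependent ℝ
        (fun i : {i : Fin K // α i = c} => Matrix.vecMulVec (h' i) (star (h' i)))) →
      ∀ π : Equiv.Perm (Fin K), Antitone (α ∘ π) →
        ∃! x, MISOBC.IsWsrOptimal α (MISOBC.orderRegion (σ ^ 2) h' π) A' P x) ∧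
    -- all solutions of the reduced problem have rank at most one
    ((∃ i, h i ≠ 0) → ∀ B r,
      MISOBC.IsWsrOptimal α (MISOBC.bcRegion (σ ^ 2) h') A' P (B, r) → ∀ i, (B i).rank ≤ 1) ∧
    -- the reduced problem is solved through its dual multiple access channel
    (∀ π : Equiv.Perm (Fin K), Antitone (α ∘ π) →
      (∃ p, MISOBC.IsMacOptimal α (σ ^ 2) A' h' P π p) ∧
      ∀ p, MISOBC.IsMacOptimal α (σ ^ 2) A' h' P π p →
        ∃ q : Fin K → ℝ, (∀ i, 0 ≤ q i) ∧
          MISOBC.IsDownlinkPower (σ ^ 2) A' h' π p q ∧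
          MISOBC.macRate A' h' π p
            ∈ MISOBC.orderRegion (σ ^ 2) h' π (MISOBC.beamCov A' h' π p q) ∧
          MISOBC.IsWsrOptimal α (MISOBC.bcRegion (σ ^ 2) h') A' P
            (MISOBC.beamCov A' h' π p q, MISOBC.macRate A' h' π p)) := by

  have hnv : 0 < σ ^ 2 := by positivity
  have hAeq : U₁ * A' * U₁.conjTranspose = A := by
    rw [hA', ← hU.eq_mul_mul]
  have hheq : (fun i => U₁.mulVec (h' i)) = h := by
    funext i
    rw [hh', hU.channel_eq hnull]
  have hne : (∃ i, h i ≠ 0) → ∃ i, h' i ≠ 0 := by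
    rintro ⟨i, hi⟩
    refine ⟨i, fun h0 => hi ?_⟩
    rw [← hheq]
    simp [h0]
  have hpd : A'.PosDef := hA' ▸ hU.posDef
  have hcompress : ∀ (S : Fin K → Matrix (Fin N) (Fin N) ℂ) (r : Fin K → ℝ),
      (∀ i, (S i).PosSemidef) →
      (MISOBC.IsWsrOptimal α (MISOBC.bcRegion (σ ^ 2) h) A P (S, r) ↔
        MISOBC.IsWsrOptimal α (MISOBC.bcRegion (σ ^ 2) h') A' P
          (fun i => U₁.conjTranspose * S i * U₁, r)) := by
    intro S r hS
    rw [← hheq, ← hAeq]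
    exact MISOBC.isWsrOptimal_iff_compress hU.orthonormal.1 hS
  refine ⟨hpd, ?_, ?_, ?_, ?_, ?_, ?_⟩
  · obtain ⟨π, hπ⟩ := MISOBC.exists_antitone_comp_perm α
    obtain ⟨x, -, hx⟩ := MISOBC.exists_isWsrOptimal (h := h') hα hnv hpd hP hπ
    exact ⟨x, hx⟩
  · intro S r
    constructor
    · intro hopt
      have hS := hopt.1.2.2
      exact ⟨_, fun i => U₁.conjTranspose * S i * U₂, fun i => U₂.conjTranspose * S i * U₂,
        (hcompress S r hS).1 hopt, fun i => ⟨hU.block_decomposition (hS i).1, hS i⟩⟩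
    · rintro ⟨B, C, D, hopt, hSB⟩
      rw [hcompress S r fun i => (hSB i).2]
      have : (fun i => U₁.conjTranspose * S i * U₁) = B := by
        funext i
        rw [(hSB i).1, hU.compress_block]
      rwa [this]
  · exact fun hh hinj =>
      MISOBC.existsUnique_isWsrOptimal_of_injective hα hnv hpd hP (hne hh) hinj
  · exact fun hind π hπ => MISOBC.existsUnique_isWsrOptimal_orderRegion hα hnv hpd hP hind hπ
  · exact fun hh B r hopt i =>
      MISOBC.rank_le_one_of_isWsrOptimal hα hnv hpd hP (hne hh) hopt i
  · intro π hπ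
    refine ⟨MISOBC.exists_isMacOptimal α hnv hpd h' hP π, fun p hp => ?_⟩
    obtain ⟨q, hq, hdown, hmem, -, hopt⟩ := hp.exists_downlink hα hnv hpd hπ
    exact ⟨q, hq, hdown, hmem, hopt⟩
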